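/- All manifolds, maps, bundles and sections are smooth ($C^\infty$). Let $M^n$ be a Riemannian manifold and let $f\colon M^n\to\mathbb R^{n+p}$ and $\hat f\colon M^n\to\mathbb R^{n+q}$ be isometric immersions. The pair $f,\hat f$ \emph{singularly extends isometrically} if there are an embedding $j\colon M^n\to N^{n+s}$ into a manifold with $s>0$ and maps $F\colon N\to\mathbb R^{n+p}$, $\hat F\colon N\to\mathbb R^{n+q}$ inducing the same (possibly degenerate) metric on $N$, such that $f=F\circ j$, $\hat f=\hat F\circ j$, and $F$ and $\hat F$ are immersions at every point of $N\setminus j(M)$. We call $\hat f$ a \emph{strongly genuine deformation} of $f$ if there is no nonempty open subset $U\subset M^n$ such that $f|_U$ and $\hat f|_U$ singularly extend isometrically. Let $L\subset T_f^\perp M$ and $\hat L\subset T_{\hat f}^\perp M$ be normal subbundles of rank $\ell\ge 0$, and let $\tau\colon L\to\hat L$ be a vector bundle isometry that preserves second fundamental forms and is parallel, that is, $\tau\circ\alpha_L=\hat\alpha_{\hat L}$ and $\tau(\nabla^\perp_X\xi)_L=(\hat\nabla^\perp_X\tau\xi)_{\hat L}$ for all $X\in TM$ and all sections $\xi$ of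 $L$, where subindices denote orthogonal projections. Put $\bar\tau=\mathrm{Id}\oplus\tau\colon TM\oplus L\to TM\oplus\hat L$ and, for $X\in TM$ and $v\in TM\oplus L$, $$\phi_\tau(X,v)=\left((\tilde\nabla_Xv)_{L^\perp},(\tilde\nabla_X\bar\tau v)_{\hat L^\perp}\right)\in L^\perp\times\hat L^\perp ,$$ where $\tilde\nabla$ is the connection of the Euclidean ambient spaces, $TM$ is identified with its images under $f_*$ and $\hat f_*$, and $L^\perp$, $\hat L^\perp$ are the orthogonal complements in the normal bundles. (The right-hand side is evaluated on local sections extending $v$ and does not depend on the extension.) Endow $L^\perp\times\hat L^\perp$ with the metric $\langle\,,\rangle=\langle\,,\rangle|_{L^\perp}-\langle\,,\rangle|_{\hat L^\perp}$; a subset $S$ of a fibre is \emph{null} if $\langle\eta,\xi\rangle=0$ for all $\eta,\xi\in S$. For a rank $d$ distribution $D\subset TM$, we say that $f$ and $\hat f$ are \emph{mutually $\bar D$-ruled} along an open set $W\subset M^n$ if for every $x\in W$ there is a totally geodesic submanifold of $M^n$, contained in $W$ and tangent to $D(x)$ at $x$, which is mapped by each of $f$ and $\hat f$ onto an open subset of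 a $d$-dimensional affine subspace. \textbf{Theorem.} Suppose that $\hat f$ is a strongly genuine deformation of $f$ and let $\tau\colon L\to\hat L$ be a parallel vector bundle isometry that preserves second fundamental forms. Let $D\subset TM\oplus L$ be a subbundle of rank $d$ such that $\phi_\tau(T_xM,D_x)$ is null for every $x\in M^n$. Then $D\subset TM$, and there is an open dense subset of $M^n$ along each connected component of which $f$ and $\hat f$ are mutually $\bar D$-ruled. -/

import Mathlib

open scoped Manifold ContDiff Topology

noncomputable section

namespace SubmanifoldGeometry

universe u

/-- Euclidean space of dimension `m`. -/
abbrev Euc (m : ℕ) : Type := EuclideanSpace ℝ (Fin m)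

/-- Smooth Riemannian metrics on an `n`-dimensional manifold `M`. -/
abbrev RiemMetric (n : ℕ) (M : Type u) [TopologicalSpace M] [ChartedSpace (Euc n) M]
    [IsManifold (𝓡 n) ∞ M] :=
  Bundle.ContMDiffRiemannianMetric (𝓡 n) ∞ (Euc n) (fun x : M => TangentSpace (𝓡 n) x)

/-- The differential at `x` of a map into Euclidean space; for a map `v` this is also the derivative
`X ↦ ∇̃_X v` with respect to the flat ambient connection. -/
def diff (n : ℕ) {M : Type u} [TopologicalSpace M] [ChartedSpace (Euc n) M] {m : ℕ}
    (f : M → Euc m) (x : M) : TangentSpace (𝓡 n) x →L[ℝ] Euc m :=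
  mfderiv (𝓡 n) 𝓘(ℝ, Euc m) f x

section Basic

variable (n : ℕ) {M : Type u} [TopologicalSpace M] [ChartedSpace (Euc n) M]
  [IsManifold (𝓡 n) ∞ M]

/-- `f : M → ℝ^m` is a (smooth) isometric immersion for the metric `g`; injectivity of the
differential follows from positivity of `g`. -/
def IsIsometricImmersion (g : RiemMetric n M) {m : ℕ} (f : M → Euc m) : Prop :=
  ContMDiff (𝓡 n) 𝓘(ℝ, Euc m) ∞ f ∧
    ∀ (x : M) (v w : TangentSpace (𝓡 n) x), inner ℝ (diff n f x v) (diff n f x w) = g.inner x v w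

/-- The vector field `Y` is smooth on the set `U`. -/
def SmoothFieldOn (Y : ∀ x : M, TangentSpace (𝓡 n) x) (U : Set M) : Prop :=
  ContMDiffOn (𝓡 n) (𝓡 n).tangent ∞ (fun x => (⟨x, Y x⟩ : TangentBundle (𝓡 n) M)) U

/-- The map `ξ` into Euclidean space is smooth on the set `U`. -/
def SmoothMapOn {m : ℕ} (ξ : M → Euc m) (U : Set M) : Prop :=
  ContMDiffOn (𝓡 n) 𝓘(ℝ, Euc m) ∞ ξ U

/-! ### Singular isometric extensions -/

/-- The pair `f : M^n → ℝ^(n+p)`, `f' : M^n → ℝ^(n+q)` singularly extends isometrically: there are a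
smooth embedding `j` of `M` into a manifold `N` of dimension `n + s`, `s > 0`, and smooth maps
`F`, `F'` on `N` inducing the same (possibly degenerate) metric on `N`, with `f = F ∘ j`,
`f' = F' ∘ j`, which are immersions away from `j(M)`. -/
def SingularlyExtends {p q : ℕ} (f : M → Euc (n + p)) (f' : M → Euc (n + q)) : Prop :=
  ∃ (s : ℕ) (_ : 0 < s) (N : Type u) (_ : TopologicalSpace N) (_ : T2Space N)
    (_ : SecondCountableTopology N) (_ : ChartedSpace (Euc (n + s)) N)
    (_ : IsManifold (𝓡 (n + s)) ∞ N)
    (j : M → N) (F : N → Euc (n + p)) (F' : N → Euc (n + q)),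
    Manifold.IsSmoothEmbedding (𝓡 n) (𝓡 (n + s)) ∞ j ∧
    ContMDiff (𝓡 (n + s)) 𝓘(ℝ, Euc (n + p)) ∞ F ∧
    ContMDiff (𝓡 (n + s)) 𝓘(ℝ, Euc (n + q)) ∞ F' ∧
    (∀ (y : N) (v w : TangentSpace (𝓡 (n + s)) y),
      inner ℝ (diff (n + s) F y v) (diff (n + s) F y w) =
        inner ℝ (diff (n + s) F' y v) (diff (n + s) F' y w)) ∧
    f = F ∘ j ∧ f' = F' ∘ j ∧
    ∀ y : N, y ∉ Set.range j → Function.Injective (diff (n + s) F y) ∧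
      Function.Injective (diff (n + s) F' y)

/-- No nonempty open subset `U` of `M` is such that `f|_U` and `f'|_U` singularly extend
isometrically. For isometric immersions `f`, `f'` this says that `f'` is a strongly genuine
deformation of `f`. -/
def StronglyGenuine {p q : ℕ} (f : M → Euc (n + p)) (f' : M → Euc (n + q)) : Prop :=
  ∀ U : TopologicalSpace.Opens M, (U : Set M).Nonempty →
    ¬ SingularlyExtends n (fun x : U => f x) (fun x : U => f' x)

/-! ### Normal subbundles, second fundamental forms, normal connections -/

/-- The tangent space `f_* T_x M`. -/
def tangentImage {m : ℕ} (f : M → Euc m) (x : M) : Submodule ℝ (Euc m) :=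
  LinearMap.range (diff n f x : TangentSpace (𝓡 n) x →ₗ[ℝ] Euc m)

/-- The normal space `T_f^⊥ M` at `x`. -/
def normalSpace {m : ℕ} (f : M → Euc m) (x : M) : Submodule ℝ (Euc m) :=
  (tangentImage n f x)ᗮ

/-- `L` is a smooth rank `r` subbundle of the normal bundle of `f`. -/
def IsNormalSubbundle {m : ℕ} (f : M → Euc m) (r : ℕ) (L : M → Submodule ℝ (Euc m)) : Prop :=
  (∀ x, L x ≤ normalSpace n f x) ∧ (∀ x, Module.finrank ℝ (L x) = r) ∧
    ∀ x, ∃ U : Set M, IsOpen U ∧ x ∈ U ∧ ∃ ξ : Fin r → M → Euc m,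
      (∀ i, SmoothMapOn n (ξ i) U) ∧ ∀ y ∈ U, Submodule.span ℝ (Set.range fun i => ξ i y) = L y

/-- The second fundamental form `α(X, Y) = (∇̃_X f_* Y)^⊥` of `f` at `x`, for `X ∈ T_x M` and a
vector field `Y`. -/
def secondFF {m : ℕ} (f : M → Euc m) (x : M) (X : TangentSpace (𝓡 n) x)
    (Y : ∀ y : M, TangentSpace (𝓡 n) y) : Euc m :=
  (normalSpace n f x).starProjection (diff n (fun y => diff n f y (Y y)) x X)

/-- The normal connection `∇^⊥_X ξ = (∇̃_X ξ)^⊥` of `f` at `x`, for a normal field `ξ`. -/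
def normalConn {m : ℕ} (f : M → Euc m) (x : M) (X : TangentSpace (𝓡 n) x) (ξ : M → Euc m) :
    Euc m :=
  (normalSpace n f x).starProjection (diff n ξ x X)

/-- The fibrewise linear isometries `τ_x : L_x → L'_x` form a smooth bundle map. -/
def SmoothBundleIsometry {m m' : ℕ} {L : M → Submodule ℝ (Euc m)} {L' : M → Submodule ℝ (Euc m')}
    (τ : ∀ x, L x ≃ₗᵢ[ℝ] L' x) : Prop :=
  ∀ (U : Set M) (ξ : ∀ x, L x), IsOpen U → SmoothMapOn n (fun x => (ξ x : Euc m)) U →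
    SmoothMapOn n (fun x => (τ x (ξ x) : Euc m')) U

/-- `τ ∘ α_L = α'_{L'}`, where `α_L` is the `L`-component of the second fundamental form. -/
def PreservesSecondFF {m m' : ℕ} (f : M → Euc m) (f' : M → Euc m')
    {L : M → Submodule ℝ (Euc m)} {L' : M → Submodule ℝ (Euc m')}
    (τ : ∀ x, L x ≃ₗᵢ[ℝ] L' x) : Prop :=
  ∀ (U : Set M) (Y : ∀ y : M, TangentSpace (𝓡 n) y), IsOpen U → SmoothFieldOn n Y U →
    ∀ x ∈ U, ∀ X : TangentSpace (𝓡 n) x,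
      τ x ((L x).orthogonalProjectionOnto (secondFF n f x X Y)) =
        (L' x).orthogonalProjectionOnto (secondFF n f' x X Y)

/-- `τ (∇^⊥_X ξ)_L = (∇'^⊥_X τξ)_{L'}` for all tangent vectors `X` and local smooth sections `ξ`
of `L`. -/
def IsParallel {m m' : ℕ} (f : M → Euc m) (f' : M → Euc m')
    {L : M → Submodule ℝ (Euc m)} {L' : M → Submodule ℝ (Euc m')}
    (τ : ∀ x, L x ≃ₗᵢ[ℝ] L' x) : Prop :=
  ∀ (U : Set M) (ξ : ∀ y, L y), IsOpen U → SmoothMapOn n (fun y => (ξ y : Euc m)) U →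
    ∀ x ∈ U, ∀ X : TangentSpace (𝓡 n) x,
      τ x ((L x).orthogonalProjectionOnto (normalConn n f x X fun y => (ξ y : Euc m))) =
        (L' x).orthogonalProjectionOnto (normalConn n f' x X fun y => (τ y (ξ y) : Euc m'))

/-! ### The bundle `TM ⊕ L` and the bilinear form `φ_τ` -/

/-- The fibre `T_x M ⊕ L_x`. -/
abbrev SumFibre {m : ℕ} (L : M → Submodule ℝ (Euc m)) (x : M) : Type :=
  TangentSpace (𝓡 n) x × L x

/-- The section `V` of `TM ⊕ L` is smooth on `U`. -/
def SmoothSectionOn {m : ℕ} {L : M → Submodule ℝ (Euc m)}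
    (V : ∀ x, SumFibre n L x) (U : Set M) : Prop :=
  SmoothFieldOn n (fun x => (V x).1) U ∧ SmoothMapOn n (fun x => ((V x).2 : Euc m)) U

/-- `D` is a smooth rank `d` subbundle of `TM ⊕ L`. -/
def IsSubbundle {m : ℕ} {L : M → Submodule ℝ (Euc m)} (d : ℕ)
    (D : ∀ x, Submodule ℝ (SumFibre n L x)) : Prop :=
  (∀ x, Module.finrank ℝ (D x) = d) ∧
    ∀ x, ∃ U : Set M, IsOpen U ∧ x ∈ U ∧ ∃ V : Fin d → ∀ y, SumFibre n L y,
      (∀ i, SmoothSectionOn n (V i) U) ∧ ∀ y ∈ U, Submodule.span ℝ (Set.range fun i => V i y) = D y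

/-- A section `(Y, ξ)` of `TM ⊕ L` as the map `f_* Y + ξ` into the ambient Euclidean space. -/
def ambient {m : ℕ} (f : M → Euc m) {L : M → Submodule ℝ (Euc m)}
    (V : ∀ x, SumFibre n L x) (x : M) : Euc m :=
  diff n f x (V x).1 + (V x).2

/-- The natural extension `τ̄ = Id ⊕ τ : TM ⊕ L → TM ⊕ L'`, on sections. -/
def tauBar {m m' : ℕ} {L : M → Submodule ℝ (Euc m)} {L' : M → Submodule ℝ (Euc m')}
    (τ : ∀ x, L x ≃ₗᵢ[ℝ] L' x) (V : ∀ x, SumFibre n L x) :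
    ∀ x, SumFibre n L' x :=
  fun x => ((V x).1, τ x (V x).2)

/-- The orthogonal complement `L^⊥` of `L` in the normal bundle of `f`, at `x`. -/
def normalCompl {m : ℕ} (f : M → Euc m) (L : M → Submodule ℝ (Euc m)) (x : M) :
    Submodule ℝ (Euc m) :=
  normalSpace n f x ⊓ (L x)ᗮ

/-- `φ_τ(X, V) = ((∇̃_X V)_{L^⊥}, (∇̃_X τ̄V)_{L'^⊥})` at `x`, for `X ∈ T_x M` and a section `V` of
`TM ⊕ L`. On sections that are smooth near `x` it depends on `V` only through `V x`. -/
def phi {m m' : ℕ} (f : M → Euc m) (f' : M → Euc m')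
    {L : M → Submodule ℝ (Euc m)} {L' : M → Submodule ℝ (Euc m')}
    (τ : ∀ x, L x ≃ₗᵢ[ℝ] L' x) (x : M) (X : TangentSpace (𝓡 n) x)
    (V : ∀ y, SumFibre n L y) : Euc m × Euc m' :=
  ((normalCompl n f L x).starProjection (diff n (ambient n f V) x X),
    (normalCompl n f' L' x).starProjection (diff n (ambient n f' (tauBar n τ V)) x X))

/-- The set `φ_τ(T_x M, D_x)`, for `D_x ⊆ T_x M ⊕ L_x`. -/
def phiImage {m m' : ℕ} (f : M → Euc m) (f' : M → Euc m')
    {L : M → Submodule ℝ (Euc m)} {L' : M → Submodule ℝ (Euc m')}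
    (τ : ∀ x, L x ≃ₗᵢ[ℝ] L' x) (x : M) (Dx : Submodule ℝ (SumFibre n L x)) :
    Set (Euc m × Euc m') :=
  {η | ∃ (X : TangentSpace (𝓡 n) x) (U : Set M) (V : ∀ y, SumFibre n L y),
    IsOpen U ∧ x ∈ U ∧ SmoothSectionOn n V U ∧ V x ∈ Dx ∧ η = phi n f f' τ x X V}

/-- `S` is a null set for the semi-Riemannian metric `⟨ , ⟩ - ⟨ , ⟩'` on the product. -/
def IsNull {m m' : ℕ} (S : Set (Euc m × Euc m')) : Prop :=
  ∀ η ∈ S, ∀ ζ ∈ S, inner ℝ η.1 ζ.1 - inner ℝ η.2 ζ.2 = 0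

/-! ### Totally geodesic submanifolds and rulings -/

/-- The derivative `X(h)` of a real function `h` at `x`, for `X ∈ T_x M`. -/
def derivAlong (h : M → ℝ) (x : M) (X : TangentSpace (𝓡 n) x) : ℝ :=
  mfderiv (𝓡 n) 𝓘(ℝ, ℝ) h x X

/-- `⟨∇_X Y, Z⟩` at `x`, for the Levi-Civita connection `∇` of `g` (Koszul formula). -/
def innerLeviCivita (g : RiemMetric n M)
    (X Y Z : ∀ y : M, TangentSpace (𝓡 n) y) (x : M) : ℝ :=
  (1 / 2 : ℝ) *
    (derivAlong n (fun y => g.inner y (Y y) (Z y)) x (X x)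
      + derivAlong n (fun y => g.inner y (X y) (Z y)) x (Y x)
      - derivAlong n (fun y => g.inner y (X y) (Y y)) x (Z x)
      + g.inner x (VectorField.mlieBracket (𝓡 n) X Y x) (Z x)
      - g.inner x (VectorField.mlieBracket (𝓡 n) X Z x) (Y x)
      - g.inner x (VectorField.mlieBracket (𝓡 n) Y Z x) (X x))

/-- The tangent space at `x` of a subset `S ⊆ M` carrying a `d`-dimensional manifold structure. -/
def tangentOf (d : ℕ) (S : Set M) [ChartedSpace (Euc d) S] (x : S) :
    Submodule ℝ (TangentSpace (𝓡 n) (x : M)) :=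
  LinearMap.range (mfderiv (𝓡 d) (𝓡 n) (Subtype.val : S → M) x :
    TangentSpace (𝓡 d) x →ₗ[ℝ] TangentSpace (𝓡 n) (x : M))

/-- `S` is totally geodesic in `(M, g)`: its second fundamental form vanishes, that is, `∇_X Y` has
no component normal to `S` whenever the fields `X`, `Y` are tangent to `S` along `S`. -/
def IsTotallyGeodesic (g : RiemMetric n M) (d : ℕ) (S : Set M)
    [ChartedSpace (Euc d) S] : Prop :=
  ∀ (U : Set M) (X Y Z : ∀ y : M, TangentSpace (𝓡 n) y), IsOpen U →
    SmoothFieldOn n X U → SmoothFieldOn n Y U → SmoothFieldOn n Z U →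
    (∀ y : S, (y : M) ∈ U → X y ∈ tangentOf n d S y ∧ Y y ∈ tangentOf n d S y) →
    ∀ x : S, (x : M) ∈ U → (∀ v ∈ tangentOf n d S x, g.inner x (Z x) v = 0) →
      innerLeviCivita n g X Y Z x = 0

/-- `f(S)` is a (relatively) open subset of a `d`-dimensional affine subspace. -/
def MapsToAffine {m : ℕ} (f : M → Euc m) (d : ℕ) (S : Set M) : Prop :=
  ∃ (A : AffineSubspace ℝ (Euc m)) (O : Set (Euc m)),
    Module.finrank ℝ A.direction = d ∧ IsOpen O ∧ f '' S = (A : Set (Euc m)) ∩ O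

/-- Along the open set `W`, the immersions `f` and `f'` are mutually `Δ̄`-ruled, for a rank `d`
distribution `Δ`: through each `x ∈ W` there is a totally geodesic embedded submanifold `S ⊆ W`,
tangent to `Δ x` at `x`, mapped by both `f` and `f'` onto open subsets of `d`-dimensional affine
subspaces. -/
def MutuallyRuledOn (g : RiemMetric n M) {m m' : ℕ}
    (f : M → Euc m) (f' : M → Euc m') (d : ℕ)
    (Δ : ∀ x : M, Submodule ℝ (TangentSpace (𝓡 n) x)) (W : Set M) : Prop :=
  ∀ x ∈ W, ∃ (S : Set M) (_ : ChartedSpace (Euc d) S) (_ : IsManifold (𝓡 d) ∞ S) (hx : x ∈ S),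
    Manifold.IsSmoothEmbedding (𝓡 d) (𝓡 n) ∞ (Subtype.val : S → M) ∧ S ⊆ W ∧
    IsTotallyGeodesic n g d S ∧ tangentOf n d S ⟨x, hx⟩ = Δ x ∧
    MapsToAffine f d S ∧ MapsToAffine f' d S

end Basic

end SubmanifoldGeometry

end

/-!
The idea is to study the maps `f + t V` and `f' + t τ̄V` on `ℝ × M`, for a local section `V` of `D`.
They restrict to `f` and `f'` at `t = 0`. Since `τ` preserves second fundamental forms and is
parallel, the components of `∇̃_X V` in `TM ⊕ L` and of `∇̃_X τ̄V` in `TM ⊕ L'` correspond to each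
other under `τ̄`, and nullity of `φ_τ` says that the remaining components have equal lengths. Hence
the two maps induce the same metric on `ℝ × M` (`norm_diff_add_eq`).

The Gram determinant of the differential of `f + t V` is a polynomial in `t` with continuous
coefficients on `M`. If it were nonzero at a single point, the first of its coefficients that does
not vanish identically would be nonzero on an open set, and the maps would be immersions there for
all small `t ≠ 0` (`exists_open_injective_pencil`), that is, a singular isometric extension. As `f'`
is a strongly genuine deformation of `f`, the differential of `f + t V` therefore has a nontrivial
kernel at every point and for every `t` (`exists_mem_ker_of_stronglyGenuine`).

At `t = 0` this says that `f_* X + s V = 0` for some `(X, s) ≠ 0`, which forces `V` to be tangent: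
`D ⊂ TM`. At `t = 1`, applied to all sections `V = ∑ aᵢ Vᵢ` of `D`, it says that the pair
`(f + V, f' + τ̄V)` is constant along curves on which the coefficient vector `a` shrinks to zero. So
near `x₀` the affine subspaces `f x₀ + f_* D` and `f' x₀ + f'_* D` lie in the images of `f` and
`f'`, and corresponding points of them come from the same point of `M`
(`exists_ball_add_mem_image`). This gives the ruling through `x₀` (`exists_ruling`). The image under
`f_*` of its tangent spaces is constant, so by the Gauss formula (`innerLeviCivita_eq`) it is
totally geodesic. No point of `M` has to be discarded: the open dense set is `M` itself.
-/

/-! ### Pencils of linear maps -/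

section LinearPencils

variable {X G F ι : Type*} [TopologicalSpace X]
  [NormedAddCommGroup G] [NormedSpace ℝ G]
  [NormedAddCommGroup F] [InnerProductSpace ℝ F]

/-- A linear map is injective if and only if the Gram determinant of the images of a finite basis
does not vanish. -/
lemma injective_iff_det_gram_ne_zero [Fintype ι] [DecidableEq ι] (b : Module.Basis ι ℝ G)
    (T : G →L[ℝ] F) :
    Function.Injective T ↔
      (Matrix.of fun i j => (inner ℝ (T (b i)) (T (b j)) : ℝ)).det ≠ 0 := by
  have key : ∀ c : ι → ℝ, inner ℝ (T (∑ i, c i • b i)) (T (∑ i, c i • b i)) =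
      c ⬝ᵥ (Matrix.of fun i j => (inner ℝ (T (b i)) (T (b j)) : ℝ)).mulVec c := by
    intro c
    simp only [map_sum, map_smul, sum_inner, inner_sum, inner_smul_left, inner_smul_right,
      dotProduct, Matrix.mulVec, Matrix.of_apply, Finset.mul_sum]
    refine Finset.sum_congr rfl fun i _ => Finset.sum_congr rfl fun j _ => ?_
    rw [conj_trivial, real_inner_comm]; ring
  constructor
  · intro hT hdet
    obtain ⟨c, hc, hc0⟩ := Matrix.exists_mulVec_eq_zero_iff.2 hdet
    have h1 := key c
    rw [hc0, dotProduct_zero, inner_self_eq_zero] at h1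
    have h2 : ∑ i, c i • b i = 0 := hT (by rw [h1, map_zero])
    exact hc (funext fun i => Fintype.linearIndependent_iff.1 b.linearIndependent c h2 i)
  · intro hdet
    rw [injective_iff_map_eq_zero]
    intro a ha
    have h3 : (Matrix.of fun i j => (inner ℝ (T (b i)) (T (b j)) : ℝ)).mulVec (b.repr a) = 0 := by
      funext i
      have : ∑ j, (b.repr a j) • b j = a := b.sum_repr a
      calc _ = inner ℝ (T (b i)) (T (∑ j, (b.repr a j) • b j)) := by
            simp only [Matrix.mulVec, dotProduct, Matrix.of_apply, map_sum, map_smul, inner_sum,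
              inner_smul_right, mul_comm]
        _ = 0 := by rw [this, ha, inner_zero_right]
    have h4 : (b.repr a : ι → ℝ) = 0 := by
      by_contra hne
      exact hdet (Matrix.exists_mulVec_eq_zero_iff.1 ⟨_, hne, h3⟩)
    have h5 : b.repr a = 0 := by ext i; exact congrFun h4 i
    simpa using h5

/-- Let `A x + t B x` be a pencil of linear maps depending continuously on a parameter `x`. If it
is injective for one value of `(t, x)`, then it is injective for all `x` in some nonempty open set
and all small `t ≠ 0`: the Gram determinant is a polynomial in `t` whose coefficients are continuous
functions of `x`, and the lowest coefficient that is not identically zero is nonzero on an open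
set. -/
lemma exists_open_injective_pencil [FiniteDimensional ℝ G] (A B : X → G →L[ℝ] F)
    (hA : Continuous A) (hB : Continuous B) {x₁ : X} {t₁ : ℝ}
    (hinj : Function.Injective (A x₁ + t₁ • B x₁)) :
    ∃ U : Set X, IsOpen U ∧ U.Nonempty ∧ ∃ ε > 0, ∀ x ∈ U, ∀ t : ℝ, t ≠ 0 → |t| < ε →
      Function.Injective (A x + t • B x) := by
  classical
  let b := Module.finBasis ℝ G
  have hc : ∀ (S T : X → G →L[ℝ] F), Continuous S → Continuous T → ∀ i j,
      Continuous fun x => (inner ℝ (S x (b i)) (T x (b j)) : ℝ) := by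
    intro S T hS hT i j
    exact (hS.clm_apply continuous_const).inner (hT.clm_apply continuous_const)
  -- The Gram determinant as a polynomial over the ring of continuous functions.
  let Q : Matrix _ _ (Polynomial C(X, ℝ)) := Matrix.of fun i j =>
    Polynomial.C ⟨_, hc A A hA hA i j⟩
      + Polynomial.C (⟨_, hc A B hA hB i j⟩ + ⟨_, hc B A hB hA i j⟩) * Polynomial.X
      + Polynomial.C ⟨_, hc B B hB hB i j⟩ * Polynomial.X ^ 2
  let ev : X → ℝ → Polynomial C(X, ℝ) →+* ℝ := fun x t =>
    Polynomial.eval₂RingHom (ContinuousMap.evalAlgHom ℝ ℝ x : C(X, ℝ) →+* ℝ) t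
  have hev : ∀ x t, ev x t Q.det =
      (Matrix.of fun i j => (inner ℝ ((A x + t • B x) (b i)) ((A x + t • B x) (b j)) : ℝ)).det := by
    intro x t
    rw [RingHom.map_det]
    congr 1
    ext i j
    simp [ev, Q, inner_add_left, inner_add_right, inner_smul_left, inner_smul_right]
    ring
  have hsum : ∀ (p : Polynomial C(X, ℝ)) x t, ev x t p =
      ∑ k ∈ Finset.range (p.natDegree + 1), p.coeff k x * t ^ k := by
    intro p x t
    simp [ev, Polynomial.eval₂_eq_sum_range]
  have hne : Q.det ≠ 0 := by
    intro h0
    rw [injective_iff_det_gram_ne_zero b, ← hev, h0, map_zero] at hinj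
    exact hinj rfl
  obtain ⟨k, q, hq, hq0⟩ : ∃ k q, Q.det = Polynomial.X ^ k * q ∧ q.coeff 0 ≠ 0 := by
    obtain ⟨q, hq⟩ : Polynomial.X ^ Q.det.natTrailingDegree ∣ Q.det :=
      Polynomial.X_pow_dvd_iff.2 fun k hk => Polynomial.coeff_eq_zero_of_lt_natTrailingDegree hk
    refine ⟨_, q, hq, fun h0 => hne (Polynomial.trailingCoeff_eq_zero.1 ?_)⟩
    rw [← Polynomial.coeff_X_pow_mul q Q.det.natTrailingDegree 0, ← hq, zero_add] at h0
    exact h0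
  obtain ⟨x₂, hx₂⟩ : ∃ x, q.coeff 0 x ≠ 0 := by
    by_contra! h
    exact hq0 (ContinuousMap.ext h)
  have hcont : Continuous fun z : X × ℝ => ev z.1 z.2 q := by
    simp only [hsum]
    exact continuous_finsetSum _ fun k _ =>
      ((q.coeff k).continuous.comp continuous_fst).mul (continuous_snd.pow k)
  have h20 : ev x₂ 0 q ≠ 0 := by
    simpa [hsum, Finset.sum_range_succ'] using hx₂
  have hnhds : ∀ᶠ z : X × ℝ in 𝓝 (x₂, 0), ev z.1 z.2 q ≠ 0 :=
    hcont.continuousAt.eventually_ne h20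
  rw [nhds_prod_eq, Filter.eventually_prod_iff] at hnhds
  obtain ⟨pa, hpa, pb, hpb, hab⟩ := hnhds
  obtain ⟨U, hUsub, hUo, hxU⟩ := mem_nhds_iff.1 hpa
  obtain ⟨ε, hε, hball⟩ := Metric.eventually_nhds_iff.1 hpb
  refine ⟨U, hUo, ⟨x₂, hxU⟩, ε, hε, fun x hx t ht htε => ?_⟩
  rw [injective_iff_det_gram_ne_zero b, ← hev, hq, map_mul]
  refine mul_ne_zero ?_ (hab (hUsub hx) (hball (by simpa using htε)))
  rw [map_pow]
  exact pow_ne_zero _ (by simpa [ev] using ht)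

end LinearPencils

/-! ### Affine slices in the image of a graph -/

section AffineSlices

variable {A E F : Type*} [NormedAddCommGroup A] [NormedSpace ℝ A] [CompleteSpace A]
  [NormedAddCommGroup E] [NormedSpace ℝ E] [CompleteSpace E]
  [NormedAddCommGroup F] [NormedSpace ℝ F]

/-- The equation `x + P (e x a) = z` has a differentiable local solution `x = χ (a, z)` near
`a = 0`, `z = u₀`, and this solution is `u₀` when `z = u₀ + P (e u₀ a)`. -/
lemma exists_implicit_solution {Ω : Set E} (hΩ : IsOpen Ω) {u₀ : E} (hu₀ : u₀ ∈ Ω)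
    {e : E → A →L[ℝ] F} (he : ContDiffOn ℝ ∞ e Ω) (P : F →L[ℝ] E) :
    ∃ (N : Set (A × E)) (χ : A × E → E), IsOpen N ∧ (0, u₀) ∈ N ∧
      (∀ y ∈ N, DifferentiableAt ℝ χ y ∧ χ y ∈ Ω ∧ χ y + P (e (χ y) y.1) = y.2 ∧
        ‖P‖ * (‖fderiv ℝ e (χ y)‖ * ‖y.1‖) < 1) ∧
      ∀ᶠ c : A in 𝓝 0, χ (c, u₀ + P (e u₀ c)) = u₀ := by
  have hed : ∀ u ∈ Ω, HasFDerivAt e (fderiv ℝ e u) u := fun u hu =>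
    ((he.contDiffAt (hΩ.mem_nhds hu)).differentiableAt (by simp)).hasFDerivAt
  let Φ : A × E → A × E := fun y => (y.1, y.2 + P (e y.2 y.1))
  have hΦc : ContDiffAt ℝ ∞ Φ (0, u₀) := by
    have h1 : ContDiffAt ℝ ∞ (fun y : A × E => e y.2) (0, u₀) :=
      (he.contDiffAt (hΩ.mem_nhds hu₀)).comp (0, u₀) contDiffAt_snd
    exact contDiffAt_fst.prodMk
      (contDiffAt_snd.add (P.contDiff.contDiffAt.comp _ (h1.clm_apply contDiffAt_fst)))
  let Φ' : (A × E) ≃L[ℝ] (A × E) := ContinuousLinearEquiv.equivOfInverse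
    ((ContinuousLinearMap.fst ℝ A E).prod (ContinuousLinearMap.snd ℝ A E +
      (P.comp (e u₀)).comp (ContinuousLinearMap.fst ℝ A E)))
    ((ContinuousLinearMap.fst ℝ A E).prod (ContinuousLinearMap.snd ℝ A E -
      (P.comp (e u₀)).comp (ContinuousLinearMap.fst ℝ A E)))
    (fun y => by simp) (fun y => by simp)
  have hΦ' : HasFDerivAt Φ (Φ' : A × E →L[ℝ] A × E) (0, u₀) := by
    have h1 : HasFDerivAt (fun y : A × E => e y.2)
        ((fderiv ℝ e u₀).comp (ContinuousLinearMap.snd ℝ A E)) (0, u₀) :=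
      (hed u₀ hu₀).comp (0, u₀) hasFDerivAt_snd
    have h2 : HasFDerivAt Φ _ (0, u₀) := hasFDerivAt_fst.prodMk
      (hasFDerivAt_snd.add (P.hasFDerivAt.comp (0, u₀) (h1.clm_apply hasFDerivAt_fst)))
    refine h2.congr_fderiv ?_
    ext y <;> simp [Φ']
  let ψ := hΦc.toOpenPartialHomeomorph Φ hΦ' (by simp)
  have hψ : ∀ y, ψ y = Φ y := fun y => rfl
  have hmem : ((0 : A), u₀) ∈ ψ.source := hΦc.mem_toOpenPartialHomeomorph_source hΦ' (by simp)
  have hΦ0 : Φ (0, u₀) = (0, u₀) := by simp [Φ]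
  have hψ0 : ψ.symm (0, u₀) = (0, u₀) := by
    conv_lhs => rw [← hΦ0, ← hψ]
    exact ψ.left_inv hmem
  have hmemt : ((0 : A), u₀) ∈ ψ.target := by
    have := ψ.map_source hmem
    rwa [hψ, hΦ0] at this
  have hsymm : ContDiffAt ℝ 1 ψ.symm (0, u₀) := by
    refine ψ.contDiffAt_symm hmemt (f₀' := Φ') ?_ ?_
    · rw [hψ0]; exact hΦ'
    · rw [hψ0]; exact hΦc.of_le (by simp)
  have hsmall : ∀ᶠ y : A × E in 𝓝 (0, u₀), ‖P‖ * (‖fderiv ℝ e y.2‖ * ‖y.1‖) < 1 := by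
    have h1 : ContinuousAt (fun y : A × E => fderiv ℝ e y.2) (0, u₀) :=
      ContinuousAt.comp (f := Prod.snd) (g := fun u => fderiv ℝ e u)
        (((he.contDiffAt (hΩ.mem_nhds hu₀)).fderiv_right (m := 0) (by simp)).continuousAt)
        continuousAt_snd
    have h2 : ContinuousAt (fun y : A × E => ‖P‖ * (‖fderiv ℝ e y.2‖ * ‖y.1‖)) (0, u₀) := by
      have h3 : ContinuousAt (fun y : A × E => ‖y.1‖) (0, u₀) := continuousAt_fst.norm
      have h4 : ContinuousAt (fun y : A × E => ‖fderiv ℝ e y.2‖) (0, u₀) :=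
        ContinuousAt.norm (E := E →L[ℝ] A →L[ℝ] F) h1
      exact continuousAt_const.mul (h4.mul h3)
    exact h2.eventually_lt continuousAt_const (by simp)
  have hev : ∀ᶠ y : A × E in 𝓝 (0, u₀), y ∈ ψ.target ∧ DifferentiableAt ℝ ψ.symm y ∧
      (ψ.symm y).2 ∈ Ω ∧ ‖P‖ * (‖fderiv ℝ e (ψ.symm y).2‖ * ‖(ψ.symm y).1‖) < 1 := by
    have h1 : Filter.Tendsto ψ.symm (𝓝 (0, u₀)) (𝓝 (0, u₀)) := by
      have := (ψ.continuousAt_symm hmemt).tendsto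
      rwa [hψ0] at this
    have h2 : ∀ᶠ y : A × E in 𝓝 (0, u₀), y.2 ∈ Ω :=
      continuousAt_snd.eventually (hΩ.mem_nhds hu₀)
    filter_upwards [ψ.open_target.mem_nhds hmemt, hsymm.eventually (by simp),
      h1.eventually h2, h1.eventually hsmall] with y hy1 hy2 hy3 hy4
    exact ⟨hy1, hy2.differentiableAt (by simp), hy3, hy4⟩
  obtain ⟨N, hNsub, hNo, hN0⟩ := mem_nhds_iff.1 hev
  refine ⟨N, fun y => (ψ.symm y).2, hNo, hN0, fun y hy => ?_, ?_⟩
  · obtain ⟨hyt, hd, hyΩ, hsm⟩ := hNsub hy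
    have h1 : Φ (ψ.symm y) = y := ψ.right_inv hyt
    have h2 : (ψ.symm y).1 = y.1 := (Prod.ext_iff.1 h1).1
    rw [h2] at hsm
    refine ⟨hd.snd, hyΩ, ?_, hsm⟩
    have h3 := (Prod.ext_iff.1 h1).2
    simpa only [Φ, h2] using h3
  · have h1 : ContinuousAt (fun c : A => (c, u₀)) 0 := by fun_prop
    filter_upwards [h1.eventually (ψ.open_source.mem_nhds hmem)] with c hc
    have h2 : ((c, u₀ + P (e u₀ c)) : A × E) = ψ (c, u₀) := rfl
    rw [h2, ψ.left_inv hc]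

/-- Let `f u + e u a` be a family of maps parametrized by `a`, where `f` is a graph in the sense
that `P ∘ f = id`. Suppose that the differential of `(u, s) ↦ f u + (1 + s) • e u a` at `(u, 0)` is
not injective, for all `u` and `a`. Then near `f u₀` the affine subspace
`f u₀ + range (e u₀)` is contained in the image of `f`.

Indeed, for small `a` the kernel of that differential is spanned by a vector that moves `s`, and
following the kernel directions from `(u₀, c)` down to the zero section gives a curve along which
`f u + e u a` stays constant. Since `P ∘ f = id`, the curve is determined by the implicit equation
`u + P (e u a) = u₀ + P (e u₀ c)` with `a = (1 - t) c`, and it ends at `u₀ + P (e u₀ c)`. -/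
lemma exists_ball_add_mem_image
    {Ω : Set E} (hΩ : IsOpen Ω) {u₀ : E} (hu₀ : u₀ ∈ Ω) {f : E → F} {e : E → A →L[ℝ] F}
    (hf : ContDiffOn ℝ ∞ f Ω) (he : ContDiffOn ℝ ∞ e Ω) (P : F →L[ℝ] E)
    (hP : ∀ u ∈ Ω, P (f u) = u)
    (hker : ∀ u ∈ Ω, ∀ a : A, ∃ (w : E) (s : ℝ), (w ≠ 0 ∨ s ≠ 0) ∧
      fderiv ℝ f u w + fderiv ℝ e u w a + s • e u a = 0) :
    ∃ ε > 0, ∀ c : A, ‖c‖ < ε →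
      u₀ + P (e u₀ c) ∈ Ω ∧ f (u₀ + P (e u₀ c)) = f u₀ + e u₀ c := by
  have hfd : ∀ u ∈ Ω, HasFDerivAt f (fderiv ℝ f u) u := fun u hu =>
    ((hf.contDiffAt (hΩ.mem_nhds hu)).differentiableAt (by simp)).hasFDerivAt
  have hed : ∀ u ∈ Ω, HasFDerivAt e (fderiv ℝ e u) u := fun u hu =>
    ((he.contDiffAt (hΩ.mem_nhds hu)).differentiableAt (by simp)).hasFDerivAt
  have hPf : ∀ u ∈ Ω, ∀ w, P (fderiv ℝ f u w) = w := by
    intro u hu w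
    have h1 : HasFDerivAt (fun u => P (f u)) (P.comp (fderiv ℝ f u)) u :=
      P.hasFDerivAt.comp u (hfd u hu)
    have h2 : HasFDerivAt (fun u => P (f u)) (ContinuousLinearMap.id ℝ E) u :=
      (hasFDerivAt_id u).congr_of_eventuallyEq
        (Filter.eventually_of_mem (hΩ.mem_nhds hu) fun y hy => hP y hy)
    exact congrArg (fun T : E →L[ℝ] E => T w) (h1.unique h2)
  obtain ⟨N, χ, hNo, hN0, hN, hχ⟩ := exists_implicit_solution hΩ hu₀ he P
  obtain ⟨r, hr, hball⟩ := Metric.isOpen_iff.1 hNo _ hN0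
  have hev2 : ∀ᶠ c : A in 𝓝 0, ‖c‖ < r ∧ ‖P (e u₀ c)‖ < r ∧ u₀ + P (e u₀ c) ∈ Ω := by
    have hc : Continuous fun c => P (e u₀ c) := by fun_prop
    have h2 : ContinuousAt (fun c : A => u₀ + P (e u₀ c)) 0 := by fun_prop
    refine (continuous_norm.continuousAt.eventually_lt continuousAt_const (by simpa)).and
      ((hc.norm.continuousAt.eventually_lt continuousAt_const (by simpa)).and
      (h2.eventually (hΩ.mem_nhds (by simpa))))
  obtain ⟨ε, hε, hεb⟩ := Metric.eventually_nhds_iff.1 (hev2.and hχ)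
  refine ⟨ε, hε, fun c hc => ?_⟩
  obtain ⟨⟨hc1, hc2, hc3⟩, hc4⟩ := hεb (y := c) (by simpa using hc)
  refine ⟨hc3, ?_⟩
  set z := u₀ + P (e u₀ c) with hz
  let y : ℝ → A × E := fun t => ((1 - t) • c, z)
  have hyc : Continuous y := by fun_prop
  have hyN : ∀ t ∈ Set.Icc (0 : ℝ) 1, y t ∈ N := by
    intro t ht
    refine hball ?_
    rw [Metric.mem_ball, Prod.dist_eq, max_lt_iff, dist_zero_right, norm_smul]
    refine ⟨?_, by simpa [y, hz] using hc2⟩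
    calc ‖(1 - t : ℝ)‖ * ‖c‖ ≤ 1 * ‖c‖ := by
          gcongr
          rw [Real.norm_eq_abs, abs_le]; constructor <;> linarith [ht.1, ht.2]
      _ < r := by simpa using hc1
  let x : ℝ → E := fun t => χ (y t)
  have hsnd : ∀ t, y t ∈ N → x t + P (e (x t) ((1 - t) • c)) = z := fun t ht => (hN _ ht).2.2.1
  let g : ℝ → F := fun t => f (x t) + e (x t) ((1 - t) • c)
  have hderiv : ∀ t, y t ∈ N → ∃ v, HasDerivAt g
      (fderiv ℝ f (x t) v + (fderiv ℝ e (x t) v ((1 - t) • c) - e (x t) c)) t := by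
    intro t ht
    obtain ⟨hd, hxΩ, -, -⟩ := hN _ ht
    have hy' : HasDerivAt y (-c, 0) t := by
      have h1 : HasDerivAt (fun t : ℝ => (1 - t) • c) ((-1 : ℝ) • c) t :=
        ((hasDerivAt_id t).const_sub 1).smul_const c
      rw [neg_one_smul] at h1
      exact h1.prodMk (hasDerivAt_const t z)
    have hx' : HasDerivAt x (fderiv ℝ χ (y t) (-c, 0)) t := hd.hasFDerivAt.comp_hasDerivAt t hy'
    have h2 : HasDerivAt (fun t => f (x t)) _ t := (hfd _ hxΩ).comp_hasDerivAt t hx'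
    have h3 : HasDerivAt (fun t => e (x t)) _ t := (hed _ hxΩ).comp_hasDerivAt t hx'
    have h4 : HasDerivAt (fun t : ℝ => (1 - t) • c) (-c) t := by
      simpa using ((hasDerivAt_id t).const_sub 1).smul_const c
    refine ⟨fderiv ℝ χ (y t) (-c, 0), (h2.add (h3.clm_apply h4)).congr_deriv ?_⟩
    rw [map_neg, ← sub_eq_add_neg]
  have hPg : ∀ t, y t ∈ N → P (g t) = z := by
    intro t ht
    rw [map_add, hP _ (hN _ ht).2.1]
    exact hsnd t ht
  have hzero : ∀ t ∈ Set.Ico (0 : ℝ) 1, HasDerivAt g 0 t := by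
    intro t ht
    have htN := hyN t ⟨ht.1, ht.2.le⟩
    obtain ⟨-, hxΩ, -, hsm⟩ := hN _ htN
    obtain ⟨v, hv⟩ := hderiv t htN
    -- `T` is injective, being close to the differential of `f`.
    set T : E → F := fun w => fderiv ℝ f (x t) w + fderiv ℝ e (x t) w ((1 - t) • c) with hT
    have hTinj : ∀ w, P (T w) = 0 → w = 0 := by
      intro w hw
      by_contra hne
      have hwpos : 0 < ‖w‖ := norm_pos_iff.2 hne
      have h1 : w = - P (fderiv ℝ e (x t) w ((1 - t) • c)) := by
        rw [hT, map_add, hPf _ hxΩ] at hw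
        exact eq_neg_of_add_eq_zero_left hw
      have h2 : ‖w‖ ≤ ‖P‖ * (‖fderiv ℝ e (x t)‖ * ‖(1 - t) • c‖) * ‖w‖ := by
        conv_lhs => rw [h1, norm_neg]
        calc _ ≤ ‖P‖ * ‖fderiv ℝ e (x t) w ((1 - t) • c)‖ := P.le_opNorm _
          _ ≤ ‖P‖ * (‖fderiv ℝ e (x t)‖ * ‖w‖ * ‖(1 - t) • c‖) := by
              gcongr
              exact ((fderiv ℝ e (x t) w).le_opNorm _).trans
                (by gcongr; exact (fderiv ℝ e (x t)).le_opNorm w)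
          _ = _ := by ring
      have h3 : ‖P‖ * (‖fderiv ℝ e (x t)‖ * ‖(1 - t) • c‖) * ‖w‖ < 1 * ‖w‖ := by gcongr
      linarith
    have hTlin : ∀ (k : ℝ) w w', T (w - k • w') = T w - k • T w' := by
      intro k w w'
      simp only [hT, map_sub, map_smul, sub_apply, smul_apply]
      module
    have hPv : P (T v - e (x t) c) = 0 := by
      have h1 : HasDerivAt (fun t => P (g t)) (P (T v - e (x t) c)) t := by
        have := P.hasFDerivAt.comp_hasDerivAt t hv
        rwa [← add_sub_assoc] at this
      have h2 : HasDerivAt (fun t => P (g t)) 0 t :=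
        (hasDerivAt_const t z).congr_of_eventuallyEq
          (Filter.eventually_of_mem ((hNo.preimage hyc).mem_nhds htN) fun s hs => hPg s hs)
      exact h1.unique h2
    obtain ⟨w, s, hne, hws⟩ := hker _ hxΩ ((1 - t) • c)
    have ht1 : (1 - t) ≠ 0 := by linarith [ht.2]
    have hws' : T w = -(s * (1 - t)) • e (x t) c := by
      rw [map_smul (e _), smul_smul] at hws
      rw [neg_smul]
      exact eq_neg_of_add_eq_zero_left hws
    have hs : s ≠ 0 := by
      intro hs
      have hw0 : w = 0 := hTinj w (by rw [hws', hs]; simp)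
      simp [hw0, hs] at hne
    -- Hence `e (x t) c` is in the range of `T`.
    set k : ℝ := -(s * (1 - t))⁻¹ with hk
    have hTw : e (x t) c = k • T w := by
      rw [hws', smul_smul, hk, neg_mul_neg, inv_mul_cancel₀ (mul_ne_zero hs ht1), one_smul]
    have h0 : v - k • w = 0 := hTinj _ (by rw [hTlin, ← hTw]; exact hPv)
    convert hv using 1
    rw [← add_sub_assoc]
    change (0 : F) = T v - e (x t) c
    rw [hTw, ← hTlin, h0]
    simp [hT]
  have hgc : ContinuousOn g (Set.Icc 0 1) := fun t ht => by
    obtain ⟨v, hv⟩ := hderiv t (hyN t ht)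
    exact hv.continuousAt.continuousWithinAt
  have hconst := constant_of_has_deriv_right_zero hgc
    (fun t ht => (hzero t ht).hasDerivWithinAt) 1 (by simp)
  have hx0 : x 0 = u₀ := by simpa [x, y] using hc4
  have hx1 : x 1 = z := by
    have := hsnd 1 (hyN 1 (by simp))
    simpa using this
  simpa [g, hx0, hx1] using hconst

end AffineSlices

/-! ### Calculus in charts -/

namespace SubmanifoldGeometry

section ChartCalculus

universe u

variable {n : ℕ} {M : Type u} [TopologicalSpace M] [ChartedSpace (Euc n) M]

lemma mdifferentiable_of_mem_maximalAtlas {φ : OpenPartialHomeomorph M (Euc n)}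
    (hφ : φ ∈ IsManifold.maximalAtlas (𝓡 n) ∞ M) : φ.MDifferentiable (𝓡 n) (𝓡 n) :=
  ⟨(contMDiffOn_of_mem_maximalAtlas hφ).mdifferentiableOn (by simp),
    (contMDiffOn_symm_of_mem_maximalAtlas hφ).mdifferentiableOn (by simp)⟩

lemma SmoothMapOn.contDiffOn_chart {φ : OpenPartialHomeomorph M (Euc n)}
    (hφ : φ ∈ IsManifold.maximalAtlas (𝓡 n) ∞ M) {m : ℕ} {h : M → Euc m} {U : Set M}
    (hh : SmoothMapOn n h U) :
    ContDiffOn ℝ ∞ (h ∘ φ.symm) (φ.target ∩ φ.symm ⁻¹' U) := by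
  rw [← contMDiffOn_iff_contDiffOn]
  exact ContMDiffOn.comp hh
    ((contMDiffOn_symm_of_mem_maximalAtlas hφ).mono Set.inter_subset_left)
    (fun u hu => hu.2)

lemma isInvertible_mfderiv_chart {φ : OpenPartialHomeomorph M (Euc n)}
    (hφ : φ ∈ IsManifold.maximalAtlas (𝓡 n) ∞ M) {x : M} (hx : x ∈ φ.source) :
    (mfderiv (𝓡 n) (𝓡 n) φ x).IsInvertible :=
  ⟨(mdifferentiable_of_mem_maximalAtlas hφ).mfderiv hx, rfl⟩

lemma isInvertible_mfderiv_chart_symm {φ : OpenPartialHomeomorph M (Euc n)}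
    (hφ : φ ∈ IsManifold.maximalAtlas (𝓡 n) ∞ M) {u : Euc n} (hu : u ∈ φ.target) :
    (mfderiv (𝓡 n) (𝓡 n) φ.symm u).IsInvertible :=
  ⟨(mdifferentiable_of_mem_maximalAtlas hφ).symm.mfderiv hu, rfl⟩

/-- The coordinate frame: the differential at `u` of the inverse of the chart `φ`, as a map from
the model space to the tangent space at `φ.symm u`. -/
noncomputable def chartFrame (φ : OpenPartialHomeomorph M (Euc n)) (u : Euc n) :
    Euc n →L[ℝ] TangentSpace (𝓡 n) (φ.symm u) :=
  mfderiv (𝓡 n) (𝓡 n) φ.symm u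

lemma chartFrame_bijective {φ : OpenPartialHomeomorph M (Euc n)}
    (hφ : φ ∈ IsManifold.maximalAtlas (𝓡 n) ∞ M) {u : Euc n} (hu : u ∈ φ.target) :
    Function.Bijective (chartFrame φ u) :=
  (mdifferentiable_of_mem_maximalAtlas hφ).symm.mfderiv_bijective hu

lemma mfderiv_chartFrame {φ : OpenPartialHomeomorph M (Euc n)}
    (hφ : φ ∈ IsManifold.maximalAtlas (𝓡 n) ∞ M) {u : Euc n} (hu : u ∈ φ.target)
    {E : Type*} [NormedAddCommGroup E] [NormedSpace ℝ E]
    {h : M → E} (hh : MDifferentiableAt (𝓡 n) 𝓘(ℝ, E) h (φ.symm u)) (w : Euc n) :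
    mfderiv (𝓡 n) 𝓘(ℝ, E) h (φ.symm u) (chartFrame φ u w) = fderiv ℝ (h ∘ φ.symm) u w := by
  have h1 := mfderiv_comp u hh
    ((mdifferentiable_of_mem_maximalAtlas hφ).mdifferentiableAt_symm hu)
  rw [mfderiv_eq_fderiv] at h1
  exact (congrArg (fun T : Euc n →L[ℝ] E => T w) h1).symm

lemma diff_chartFrame {φ : OpenPartialHomeomorph M (Euc n)}
    (hφ : φ ∈ IsManifold.maximalAtlas (𝓡 n) ∞ M) {u : Euc n} (hu : u ∈ φ.target) {m : ℕ}
    {h : M → Euc m} (hh : MDifferentiableAt (𝓡 n) 𝓘(ℝ, Euc m) h (φ.symm u)) (w : Euc n) :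
    diff n h (φ.symm u) (chartFrame φ u w) = fderiv ℝ (h ∘ φ.symm) u w :=
  mfderiv_chartFrame hφ hu hh w

lemma differentiableAt_comp_chart_symm {φ : OpenPartialHomeomorph M (Euc n)}
    (hφ : φ ∈ IsManifold.maximalAtlas (𝓡 n) ∞ M) {u : Euc n} (hu : u ∈ φ.target)
    {E : Type*} [NormedAddCommGroup E] [NormedSpace ℝ E]
    {h : M → E} (hh : MDifferentiableAt (𝓡 n) 𝓘(ℝ, E) h (φ.symm u)) :
    DifferentiableAt ℝ (h ∘ φ.symm) u :=
  mdifferentiableAt_iff_differentiableAt.1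
    (hh.comp u ((mdifferentiable_of_mem_maximalAtlas hφ).mdifferentiableAt_symm hu))

section

variable [IsManifold (𝓡 n) ∞ M]

lemma exists_chart_symm_eq (x : M) : ∃ φ ∈ IsManifold.maximalAtlas (𝓡 n) ∞ M,
    ∃ u ∈ φ.target, φ.symm u = x :=
  ⟨chartAt (Euc n) x, IsManifold.chart_mem_maximalAtlas x, chartAt (Euc n) x x,
    mem_chart_target _ x, (chartAt (Euc n) x).left_inv (mem_chart_source _ x)⟩

/-- Every tangent vector extends to a local smooth vector field. -/
lemma exists_smoothFieldOn (x : M) (X : TangentSpace (𝓡 n) x) :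
    ∃ (Y : ∀ y : M, TangentSpace (𝓡 n) y) (U : Set M), IsOpen U ∧ x ∈ U ∧
      SmoothFieldOn n Y U ∧ Y x = X := by
  have hφ : chartAt (Euc n) x ∈ IsManifold.maximalAtlas (𝓡 n) ∞ M :=
    IsManifold.chart_mem_maximalAtlas x
  have hx : x ∈ (chartAt (Euc n) x).source := mem_chart_source _ x
  let w : Euc n := mfderiv (𝓡 n) (𝓡 n) (chartAt (Euc n) x) x X
  let W : ∀ u : Euc n, TangentSpace (𝓡 n) u := fun _ => w
  refine ⟨VectorField.mpullback (𝓡 n) (𝓡 n) (chartAt (Euc n) x) W,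
    (chartAt (Euc n) x).source, (chartAt (Euc n) x).open_source, hx, fun y hy => ?_, ?_⟩
  · have hW : ContMDiffAt (𝓡 n) (𝓡 n).tangent ∞
        (fun u => (⟨u, W u⟩ : TangentBundle (𝓡 n) (Euc n))) (chartAt (Euc n) x y) :=
      contMDiffAt_vectorSpace_iff_contDiffAt.2 contDiffAt_const
    exact (ContMDiffAt.mpullback_vectorField_preimage hW
      (contMDiffAt_of_mem_maximalAtlas hφ hy) (isInvertible_mfderiv_chart hφ hy)
      (by simp)).contMDiffWithinAt
  · rw [VectorField.mpullback_apply]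
    exact (isInvertible_mfderiv_chart hφ hx).inverse_apply_self X

lemma SmoothFieldOn.smoothMapOn_diff {m : ℕ} {f : M → Euc m}
    (hf : ContMDiff (𝓡 n) 𝓘(ℝ, Euc m) ∞ f) {Y : ∀ y : M, TangentSpace (𝓡 n) y} {U : Set M}
    (hY : SmoothFieldOn n Y U) : SmoothMapOn n (fun y => diff n f y (Y y)) U := by
  have h1 : ContMDiff (𝓡 n).tangent 𝓘(ℝ, Euc m).tangent ∞
      (tangentMap (𝓡 n) 𝓘(ℝ, Euc m) f) := hf.contMDiff_tangentMap (by simp)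
  exact (contMDiff_snd_tangentBundle_modelSpace (Euc m) 𝓘(ℝ, Euc m)).comp_contMDiffOn
    (h1.comp_contMDiffOn hY)

/-- The Leibniz rule for the inner product of two maps into Euclidean space. -/
lemma derivAlong_inner {m : ℕ} {a b : M → Euc m} {x : M}
    (ha : MDifferentiableAt (𝓡 n) 𝓘(ℝ, Euc m) a x)
    (hb : MDifferentiableAt (𝓡 n) 𝓘(ℝ, Euc m) b x) (X : TangentSpace (𝓡 n) x) :
    derivAlong n (fun y => (inner ℝ (a y) (b y) : ℝ)) x X =
      inner ℝ (diff n a x X) (b x) + inner ℝ (a x) (diff n b x X) := by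
  obtain ⟨φ, hφ, u, hu, rfl⟩ := exists_chart_symm_eq (n := n) x
  obtain ⟨w, rfl⟩ := (chartFrame_bijective hφ hu).2 X
  have ha' := differentiableAt_comp_chart_symm hφ hu ha
  have hb' := differentiableAt_comp_chart_symm hφ hu hb
  have hab : MDifferentiableAt (𝓡 n) 𝓘(ℝ, ℝ) (fun y => (inner ℝ (a y) (b y) : ℝ)) (φ.symm u) := by
    have h1 : MDifferentiableAt 𝓘(ℝ, Euc n) 𝓘(ℝ, ℝ)
        (fun v => (inner ℝ ((a ∘ φ.symm) v) ((b ∘ φ.symm) v) : ℝ)) (φ (φ.symm u)) := by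
      rw [φ.right_inv hu, mdifferentiableAt_iff_differentiableAt]
      exact ha'.inner ℝ hb'
    have h2 := h1.comp (φ.symm u)
      ((mdifferentiable_of_mem_maximalAtlas hφ).mdifferentiableAt (φ.map_target hu))
    refine h2.congr_of_eventuallyEq ?_
    filter_upwards [φ.open_source.mem_nhds (φ.map_target hu)] with y hy
    simp [φ.left_inv hy]
  rw [derivAlong, mfderiv_chartFrame hφ hu hab, diff_chartFrame hφ hu ha, diff_chartFrame hφ hu hb]
  have h3 := fderiv_inner_apply ℝ ha' hb' w
  rw [add_comm]
  exact h3

end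

lemma SmoothMapOn.mdifferentiableAt {m : ℕ} {h : M → Euc m} {U : Set M}
    (hh : SmoothMapOn n h U) (hU : IsOpen U) {x : M} (hx : x ∈ U) :
    MDifferentiableAt (𝓡 n) 𝓘(ℝ, Euc m) h x :=
  (ContMDiffOn.contMDiffAt hh (hU.mem_nhds hx)).mdifferentiableAt (by simp)

lemma diff_add {m : ℕ} {a b : M → Euc m} {x : M}
    (ha : MDifferentiableAt (𝓡 n) 𝓘(ℝ, Euc m) a x)
    (hb : MDifferentiableAt (𝓡 n) 𝓘(ℝ, Euc m) b x) (X : TangentSpace (𝓡 n) x) :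
    diff n (fun y => a y + b y) x X = diff n a x X + diff n b x X :=
  congrArg (fun T : TangentSpace (𝓡 n) x →L[ℝ] Euc m => T X) (mfderiv_add ha hb)

end ChartCalculus

end SubmanifoldGeometry

/-! ### The Gauss formula for the Koszul connection -/

namespace SubmanifoldGeometry

section Koszul

universe u

variable {n : ℕ} {M : Type u} [TopologicalSpace M] [ChartedSpace (Euc n) M]
  [IsManifold (𝓡 n) ∞ M]

lemma minSmoothness_two_le_infty : minSmoothness ℝ 2 ≤ ∞ := by
  rw [minSmoothness_of_isRCLikeNormedField]
  exact WithTop.coe_le_coe.2 (le_top : (2 : ℕ∞) ≤ ⊤)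

/-- The torsion-free property of the flat ambient connection:
`f_* [X, Y] = ∇̃_X f_*Y - ∇̃_Y f_*X`. -/
lemma diff_mlieBracket {m : ℕ} {f : M → Euc m} (hf : ContMDiff (𝓡 n) 𝓘(ℝ, Euc m) ∞ f)
    {X Y : ∀ y : M, TangentSpace (𝓡 n) y} {U : Set M} (hU : IsOpen U) (hX : SmoothFieldOn n X U)
    (hY : SmoothFieldOn n Y U) {x : M} (hx : x ∈ U) :
    diff n f x (VectorField.mlieBracket (𝓡 n) X Y x) =
      diff n (fun y => diff n f y (Y y)) x (X x) - diff n (fun y => diff n f y (X y)) x (Y x) := by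
  obtain ⟨φ, hφ, u, hu, rfl⟩ := exists_chart_symm_eq (n := n) x
  let pull : (∀ y : M, TangentSpace (𝓡 n) y) → Euc n → Euc n := fun Z v =>
    VectorField.mpullback (𝓡 n) (𝓡 n) φ.symm Z v
  have hframe : ∀ (Z : ∀ y : M, TangentSpace (𝓡 n) y), ∀ v ∈ φ.target,
      chartFrame φ v (pull Z v) = Z (φ.symm v) := fun Z v hv =>
    (isInvertible_mfderiv_chart_symm hφ hv).self_apply_inverse (Z (φ.symm v))
  have hφs : ContMDiffAt (𝓡 n) (𝓡 n) ∞ φ.symm u := contMDiffAt_symm_of_mem_maximalAtlas hφ hu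
  have hpull : ∀ Z : ∀ y : M, TangentSpace (𝓡 n) y, SmoothFieldOn n Z U →
      DifferentiableAt ℝ (pull Z) u := by
    intro Z hZ
    have h1 := ContMDiffAt.mpullback_vectorField_preimage
      (ContMDiffOn.contMDiffAt hZ (hU.mem_nhds hx)) hφs (isInvertible_mfderiv_chart_symm hφ hu)
      (by simp)
    exact (contMDiffAt_vectorSpace_iff_contDiffAt.1 h1).differentiableAt (by simp)
  have hfφ : ContDiffAt ℝ ∞ (f ∘ φ.symm) u :=
    contMDiffAt_iff_contDiffAt.1 (hf.contMDiffAt.comp u hφs)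
  have hfm : ∀ v : M, MDifferentiableAt (𝓡 n) 𝓘(ℝ, Euc m) f v := fun v =>
    hf.contMDiffAt.mdifferentiableAt (by simp)
  -- The derivative of `f_* Z` in the chart.
  have hD : ∀ Z : ∀ y : M, TangentSpace (𝓡 n) y, SmoothFieldOn n Z U → ∀ w : Euc n,
      diff n (fun y => diff n f y (Z y)) (φ.symm u) (chartFrame φ u w) =
        fderiv ℝ (f ∘ φ.symm) u (fderiv ℝ (pull Z) u w) +
          fderiv ℝ (fderiv ℝ (f ∘ φ.symm)) u w (pull Z u) := by
    intro Z hZ w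
    rw [diff_chartFrame hφ hu ((hZ.smoothMapOn_diff hf).mdifferentiableAt hU hx)]
    have h1 : ((fun y => diff n f y (Z y)) ∘ φ.symm) =ᶠ[𝓝 u]
        fun v => fderiv ℝ (f ∘ φ.symm) v (pull Z v) := by
      filter_upwards [φ.open_target.mem_nhds hu] with v hv
      rw [← diff_chartFrame hφ hv (hfm _), hframe Z v hv]
      rfl
    have h2 : DifferentiableAt ℝ (fderiv ℝ (f ∘ φ.symm)) u :=
      (hfφ.fderiv_right (m := 1) (one_add_one_eq_two.trans_le
        (WithTop.coe_le_coe.2 (le_top : (2 : ℕ∞) ≤ ⊤)))).differentiableAt (by simp)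
    rw [h1.fderiv_eq, fderiv_clm_apply h2 (hpull Z hZ)]
    rfl
  have hsymm : ∀ v w, fderiv ℝ (fderiv ℝ (f ∘ φ.symm)) u v w =
      fderiv ℝ (fderiv ℝ (f ∘ φ.symm)) u w v :=
    fun v w => (hfφ.isSymmSndFDerivAt minSmoothness_two_le_infty).eq v w
  have hbr : pull (VectorField.mlieBracket (𝓡 n) X Y) u =
      VectorField.lieBracket ℝ (pull X) (pull Y) u := by
    have : IsManifold (𝓡 n) (minSmoothness ℝ 2) M := .of_le minSmoothness_two_le_infty
    have h1 := VectorField.mpullback_mlieBracket (I := 𝓡 n) (I' := 𝓡 n) (f := φ.symm) (V := X)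
      (W := Y) (x₀ := u) (n := ∞)
      ((ContMDiffOn.contMDiffAt hX (hU.mem_nhds hx)).mdifferentiableAt (by simp))
      ((ContMDiffOn.contMDiffAt hY (hU.mem_nhds hx)).mdifferentiableAt (by simp)) hφs
      minSmoothness_two_le_infty
    refine Eq.trans h1 ?_
    rw [← VectorField.mlieBracketWithin_univ, VectorField.mlieBracketWithin_eq_lieBracketWithin]
    exact congrFun VectorField.lieBracketWithin_univ u
  rw [← hframe (VectorField.mlieBracket (𝓡 n) X Y) u hu, diff_chartFrame hφ hu (hfm _), hbr,
    ← hframe X u hu, ← hframe Y u hu, hD Y hY, hD X hX, VectorField.lieBracket_eq]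
  simp only [map_sub]
  rw [hsymm (pull Y u) (pull X u)]
  abel

/-- The Gauss formula: for an isometric immersion `f`, the tangential part of `∇̃_X f_*Y` is
`f_* ∇_X Y`, with `∇` the Levi-Civita connection. -/
lemma innerLeviCivita_eq {g : RiemMetric n M} {m : ℕ} {f : M → Euc m}
    (hf : IsIsometricImmersion n g f)
    {X Y Z : ∀ y : M, TangentSpace (𝓡 n) y} {U : Set M} (hU : IsOpen U)
    (hX : SmoothFieldOn n X U) (hY : SmoothFieldOn n Y U) (hZ : SmoothFieldOn n Z U)
    {x : M} (hx : x ∈ U) :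
    innerLeviCivita n g X Y Z x =
      inner ℝ (diff n (fun y => diff n f y (Y y)) x (X x)) (diff n f x (Z x)) := by
  have hd : ∀ V : ∀ y : M, TangentSpace (𝓡 n) y, SmoothFieldOn n V U →
      MDifferentiableAt (𝓡 n) 𝓘(ℝ, Euc m) (fun y => diff n f y (V y)) x := fun V hV =>
    (hV.smoothMapOn_diff hf.1).mdifferentiableAt hU hx
  have key : ∀ V W : ∀ y : M, TangentSpace (𝓡 n) y, SmoothFieldOn n V U → SmoothFieldOn n W U →
      ∀ T : TangentSpace (𝓡 n) x, derivAlong n (fun y => g.inner y (V y) (W y)) x T =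
        inner ℝ (diff n (fun y => diff n f y (V y)) x T) (diff n f x (W x)) +
          inner ℝ (diff n (fun y => diff n f y (W y)) x T) (diff n f x (V x)) := by
    intro V W hV hW T
    simp only [← hf.2]
    rw [derivAlong_inner (hd V hV) (hd W hW),
      real_inner_comm (diff n f x (V x)) (diff n (fun y => diff n f y (W y)) x T)]
  unfold innerLeviCivita
  rw [key Y Z hY hZ, key X Z hX hZ, key X Y hX hY]
  simp only [← hf.2]
  rw [diff_mlieBracket hf.1 hU hX hY hx, diff_mlieBracket hf.1 hU hX hZ hx,
    diff_mlieBracket hf.1 hU hY hZ hx]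
  simp only [inner_sub_left]
  ring

end Koszul

end SubmanifoldGeometry

/-! ### Metrics induced by `f + t V` and `f' + t τ̄V` -/

namespace SubmanifoldGeometry

/-- Pythagoras for the decomposition `E = T ⊕ L ⊕ (T ⊕ L)ᗮ`. -/
lemma norm_sq_eq_add_norm_sq_add_norm_sq {E : Type*} [NormedAddCommGroup E]
    [InnerProductSpace ℝ E] [FiniteDimensional ℝ E] {T L : Submodule ℝ E} (h : L ≤ Tᗮ) (a : E) :
    ‖a‖ ^ 2 = ‖T.starProjection a‖ ^ 2 + ‖L.orthogonalProjectionOnto a‖ ^ 2 +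
      ‖(Tᗮ ⊓ Lᗮ).starProjection a‖ ^ 2 := by
  have hL : L.starProjection (Tᗮ.starProjection a) = L.starProjection a :=
    congrArg (fun S : E →L[ℝ] E => S a) (Submodule.starProjection_comp_starProjection_of_le h)
  have hT : a = T.starProjection a + Tᗮ.starProjection a :=
    (T.starProjection_add_starProjection_orthogonal a).symm
  have hb : Tᗮ.starProjection a = L.starProjection a + Lᗮ.starProjection (Tᗮ.starProjection a) := by
    rw [← hL, L.starProjection_add_starProjection_orthogonal]
  have hC : (Tᗮ ⊓ Lᗮ).starProjection a = Lᗮ.starProjection (Tᗮ.starProjection a) := by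
    refine Submodule.eq_starProjection_of_mem_of_inner_eq_zero ⟨?_, ?_⟩ fun w hw => ?_
    · rw [← add_sub_cancel_left (L.starProjection a) (Lᗮ.starProjection _), ← hb]
      exact Tᗮ.sub_mem (Tᗮ.starProjection_apply_mem a) (h (L.starProjection_apply_mem a))
    · exact Lᗮ.starProjection_apply_mem _
    · have h1 : a - Lᗮ.starProjection (Tᗮ.starProjection a) =
          T.starProjection a + L.starProjection a := by
        rw [sub_eq_iff_eq_add, add_assoc, ← hb]
        exact hT
      rw [h1, inner_add_left, hw.1 _ (T.starProjection_apply_mem a),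
        hw.2 _ (L.starProjection_apply_mem a), add_zero]
  rw [hC, T.norm_sq_eq_add_norm_sq_starProjection a,
    L.norm_sq_eq_add_norm_sq_starProjection (Tᗮ.starProjection a), hL, add_assoc]
  rfl

section Intertwining

universe u

variable {n : ℕ} {M : Type u} [TopologicalSpace M] [ChartedSpace (Euc n) M]
  {m m' : ℕ} {f : M → Euc m} {f' : M → Euc m'}
  {L : M → Submodule ℝ (Euc m)} {L' : M → Submodule ℝ (Euc m')}

/-- The components of `a` and `a'` in `T_x M ⊕ L_x` and `T_x M ⊕ L'_x` correspond to each other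
under `τ̄ = Id ⊕ τ`. The tangential components are encoded by their inner products with `T_x M`. -/
def Intertwined (f : M → Euc m) (f' : M → Euc m') (τ : ∀ x, L x ≃ₗᵢ[ℝ] L' x) (x : M)
    (a : Euc m) (a' : Euc m') : Prop :=
  (∀ Z : TangentSpace (𝓡 n) x,
      (inner ℝ a (diff n f x Z) : ℝ) = inner ℝ a' (diff n f' x Z)) ∧
    τ x ((L x).orthogonalProjectionOnto a) = (L' x).orthogonalProjectionOnto a'

lemma Intertwined.add {τ : ∀ x, L x ≃ₗᵢ[ℝ] L' x} {x : M} {a b : Euc m} {a' b' : Euc m'}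
    (ha : Intertwined (n := n) f f' τ x a a') (hb : Intertwined (n := n) f f' τ x b b') :
    Intertwined (n := n) f f' τ x (a + b) (a' + b') :=
  ⟨fun Z => by rw [inner_add_left, inner_add_left, ha.1, hb.1],
    by rw [map_add, map_add, map_add, ha.2, hb.2]⟩

lemma Intertwined.smul {τ : ∀ x, L x ≃ₗᵢ[ℝ] L' x} {x : M} {a : Euc m} {a' : Euc m'}
    (ha : Intertwined (n := n) f f' τ x a a') (c : ℝ) :
    Intertwined (n := n) f f' τ x (c • a) (c • a') :=
  ⟨fun Z => by rw [inner_smul_left, inner_smul_left, ha.1],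
    by rw [map_smul, map_smul, map_smul, ha.2]⟩

lemma diff_mem_tangentImage (f : M → Euc m) (x : M) (X : TangentSpace (𝓡 n) x) :
    diff n f x X ∈ tangentImage n f x := ⟨X, rfl⟩

lemma inner_diff_eq_zero {x : M} {ξ : Euc m} (hξ : ξ ∈ normalSpace n f x)
    (X : TangentSpace (𝓡 n) x) : (inner ℝ ξ (diff n f x X) : ℝ) = 0 := by
  rw [real_inner_comm]
  exact hξ _ (diff_mem_tangentImage f x X)

lemma orthogonalProjectionOnto_diff (hL : ∀ x, L x ≤ normalSpace n f x) (x : M)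
    (X : TangentSpace (𝓡 n) x) : (L x).orthogonalProjectionOnto (diff n f x X) = 0 := by
  refine Submodule.orthogonalProjectionOnto_apply_of_mem_orthogonal fun ξ hξ => ?_
  exact inner_diff_eq_zero (hL x hξ) X

lemma orthogonalProjectionOnto_normalSpace (hL : ∀ x, L x ≤ normalSpace n f x) (x : M)
    (a : Euc m) : (L x).orthogonalProjectionOnto ((normalSpace n f x).starProjection a) =
      (L x).orthogonalProjectionOnto a :=
  Submodule.orthogonalProjectionOnto_starProjection_of_le (hL x) a

lemma starProjection_normalCompl_diff (x : M) (X : TangentSpace (𝓡 n) x) :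
    (normalCompl n f L x).starProjection (diff n f x X) = 0 := by
  rw [Submodule.starProjection_apply_eq_zero_iff]
  intro ξ hξ
  exact inner_diff_eq_zero hξ.1 X

lemma starProjection_normalCompl_ambient (V : ∀ x, SumFibre n L x) (x : M) :
    (normalCompl n f L x).starProjection (ambient n f V x) = 0 := by
  rw [ambient, map_add, starProjection_normalCompl_diff, zero_add,
    Submodule.starProjection_apply_eq_zero_iff]
  intro ξ hξ
  rw [real_inner_comm]
  exact hξ.2 _ (V x).2.2

variable [IsManifold (𝓡 n) ∞ M] {g : RiemMetric n M}

/-- Vectors with corresponding components have equal norms, up to the contribution of `L^⊥` and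
`L'^⊥`. -/
lemma Intertwined.norm_eq (hf : IsIsometricImmersion n g f) (hf' : IsIsometricImmersion n g f')
    (hL : ∀ x, L x ≤ normalSpace n f x) (hL' : ∀ x, L' x ≤ normalSpace n f' x)
    {τ : ∀ x, L x ≃ₗᵢ[ℝ] L' x} {x : M} {a : Euc m} {a' : Euc m'}
    (ha : Intertwined (n := n) f f' τ x a a')
    (hC : ‖(normalCompl n f L x).starProjection a‖ =
      ‖(normalCompl n f' L' x).starProjection a'‖) : ‖a‖ = ‖a'‖ := by
  obtain ⟨A, hA⟩ := (tangentImage n f x).starProjection_apply_mem a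
  obtain ⟨A', hA'⟩ := (tangentImage n f' x).starProjection_apply_mem a'
  have h1 : ∀ Z, (inner ℝ a (diff n f x Z) : ℝ) = g.inner x A Z := fun Z => by
    rw [← hf.2]
    have := Submodule.starProjection_inner_eq_zero a _ (diff_mem_tangentImage f x Z)
    rw [inner_sub_left, sub_eq_zero] at this
    rw [this, ← hA]; rfl
  have h2 : ∀ Z, (inner ℝ a' (diff n f' x Z) : ℝ) = g.inner x A' Z := fun Z => by
    rw [← hf'.2]
    have := Submodule.starProjection_inner_eq_zero a' _ (diff_mem_tangentImage f' x Z)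
    rw [inner_sub_left, sub_eq_zero] at this
    rw [this, ← hA']; rfl
  have h3 : ∀ Z, g.inner x A Z = g.inner x A' Z := fun Z => by rw [← h1, ← h2, ha.1]
  have hT : ‖(tangentImage n f x).starProjection a‖ ^ 2 =
      ‖(tangentImage n f' x).starProjection a'‖ ^ 2 := by
    rw [← real_inner_self_eq_norm_sq, ← real_inner_self_eq_norm_sq, ← hA, ← hA']
    change inner ℝ (diff n f x A) (diff n f x A) = inner ℝ (diff n f' x A') (diff n f' x A')
    have h4 : g.inner x A A' = g.inner x A' A := by
      rw [← hf.2, ← hf.2, real_inner_comm]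
    rw [hf.2, hf'.2, h3, ← h4, h3]
  have hLn : ‖(L x).orthogonalProjectionOnto a‖ = ‖(L' x).orthogonalProjectionOnto a'‖ := by
    rw [← ha.2, LinearIsometryEquiv.norm_map]
  have hsq : ‖a‖ ^ 2 = ‖a'‖ ^ 2 := by
    rw [norm_sq_eq_add_norm_sq_add_norm_sq (hL x) a,
      norm_sq_eq_add_norm_sq_add_norm_sq (hL' x) a', hLn]
    change _ + _ + ‖(normalCompl n f L x).starProjection a‖ ^ 2 =
      _ + _ + ‖(normalCompl n f' L' x).starProjection a'‖ ^ 2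
    rw [hC]
    congr 2
  exact (sq_eq_sq₀ (norm_nonneg _) (norm_nonneg _)).1 hsq

lemma intertwined_diff (hf : IsIsometricImmersion n g f) (hf' : IsIsometricImmersion n g f')
    (hL : ∀ x, L x ≤ normalSpace n f x) (hL' : ∀ x, L' x ≤ normalSpace n f' x)
    (τ : ∀ x, L x ≃ₗᵢ[ℝ] L' x) (x : M) (X : TangentSpace (𝓡 n) x) :
    Intertwined (n := n) f f' τ x (diff n f x X) (diff n f' x X) :=
  ⟨fun Z => by rw [hf.2, hf'.2],
    by rw [orthogonalProjectionOnto_diff hL, orthogonalProjectionOnto_diff hL', map_zero]⟩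

lemma intertwined_ambient (hf : IsIsometricImmersion n g f) (hf' : IsIsometricImmersion n g f')
    (hL : ∀ x, L x ≤ normalSpace n f x) (hL' : ∀ x, L' x ≤ normalSpace n f' x)
    (τ : ∀ x, L x ≃ₗᵢ[ℝ] L' x) (V : ∀ x, SumFibre n L x) (x : M) :
    Intertwined (n := n) f f' τ x (ambient n f V x) (ambient n f' (tauBar n τ V) x) := by
  refine (intertwined_diff hf hf' hL hL' τ x (V x).1).add ⟨fun Z => ?_, ?_⟩
  · rw [inner_diff_eq_zero (hL x (V x).2.2),
      inner_diff_eq_zero (hL' x (tauBar n τ V x).2.2)]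
  · rw [Submodule.orthogonalProjectionOnto_mem_subspace_eq_self,
      Submodule.orthogonalProjectionOnto_mem_subspace_eq_self]
    rfl

/-- The components of `∇̃_X V` and `∇̃_X τ̄V` in `TM ⊕ L` and `TM ⊕ L'` correspond to each other
under `τ̄`. For the tangential components this follows from the Gauss formula and from
`⟨∇̃_X ξ, Z⟩ = -⟨ξ, α_L(X, Z)⟩` for sections `ξ` of `L`. -/
lemma intertwined_diff_ambient (hf : IsIsometricImmersion n g f)
    (hf' : IsIsometricImmersion n g f')
    (hL : ∀ x, L x ≤ normalSpace n f x) (hL' : ∀ x, L' x ≤ normalSpace n f' x)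
    {τ : ∀ x, L x ≃ₗᵢ[ℝ] L' x} (hτ : SmoothBundleIsometry n τ) (hτpar : IsParallel n f f' τ)
    (hτsff : PreservesSecondFF n f f' τ) {V : ∀ x, SumFibre n L x} {U : Set M} (hU : IsOpen U)
    (hV : SmoothSectionOn n V U) {x : M} (hx : x ∈ U) (X : TangentSpace (𝓡 n) x) :
    Intertwined (n := n) f f' τ x (diff n (ambient n f V) x X)
      (diff n (ambient n f' (tauBar n τ V)) x X) := by
  have hξ' : SmoothMapOn n (fun y => (τ y (V y).2 : Euc m')) U := hτ U (fun y => (V y).2) hU hV.2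
  have hdY := (hV.1.smoothMapOn_diff hf.1).mdifferentiableAt hU hx
  have hdY' := (hV.1.smoothMapOn_diff hf'.1).mdifferentiableAt hU hx
  have hdξ := hV.2.mdifferentiableAt hU hx
  have hdξ' := hξ'.mdifferentiableAt hU hx
  have h1 : diff n (ambient n f V) x X = diff n (fun y => diff n f y (V y).1) x X +
      diff n (fun y => ((V y).2 : Euc m)) x X := diff_add hdY hdξ X
  have h2 : diff n (ambient n f' (tauBar n τ V)) x X = diff n (fun y => diff n f' y (V y).1) x X +
      diff n (fun y => (τ y (V y).2 : Euc m')) x X := diff_add hdY' hdξ' X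
  rw [h1, h2]
  refine Intertwined.add ⟨fun Z => ?_, ?_⟩ ⟨fun Z => ?_, ?_⟩
  · obtain ⟨X₁, U₁, hU₁, hx₁, hX₁, rfl⟩ := exists_smoothFieldOn x X
    obtain ⟨Z₁, U₂, hU₂, hx₂, hZ₁, rfl⟩ := exists_smoothFieldOn x Z
    have hO : IsOpen (U ∩ (U₁ ∩ U₂)) := hU.inter (hU₁.inter hU₂)
    have e1 : SmoothFieldOn n X₁ (U ∩ (U₁ ∩ U₂)) :=
      ContMDiffOn.mono hX₁ fun y hy => hy.2.1
    have e2 : SmoothFieldOn n (fun y => (V y).1) (U ∩ (U₁ ∩ U₂)) :=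
      ContMDiffOn.mono hV.1 fun y hy => hy.1
    have e3 : SmoothFieldOn n Z₁ (U ∩ (U₁ ∩ U₂)) :=
      ContMDiffOn.mono hZ₁ fun y hy => hy.2.2
    exact (innerLeviCivita_eq hf hO e1 e2 e3 ⟨hx, hx₁, hx₂⟩).symm.trans
      (innerLeviCivita_eq hf' hO e1 e2 e3 ⟨hx, hx₁, hx₂⟩)
  · have h3 := hτsff U (fun y => (V y).1) hU hV.1 x hx X
    rw [secondFF, secondFF, orthogonalProjectionOnto_normalSpace hL,
      orthogonalProjectionOnto_normalSpace hL'] at h3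
    exact h3
  · obtain ⟨Z₁, U₂, hU₂, hx₂, hZ₁, rfl⟩ := exists_smoothFieldOn x Z
    have aux : ∀ {k : ℕ} {h : M → Euc k} {K : M → Submodule ℝ (Euc k)}
        (_ : ∀ y, K y ≤ normalSpace n h y)
        (_ : ContMDiff (𝓡 n) 𝓘(ℝ, Euc k) ∞ h) (ξ : ∀ y, K y)
        (_ : MDifferentiableAt (𝓡 n) 𝓘(ℝ, Euc k) (fun y => (ξ y : Euc k)) x),
        (inner ℝ (diff n (fun y => (ξ y : Euc k)) x X) (diff n h x (Z₁ x)) : ℝ) =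
          - inner ℝ (ξ x) ((K x).orthogonalProjectionOnto (secondFF n h x X Z₁)) := by
      intro k h K hK hh ξ hξ
      have h4 := derivAlong_inner hξ ((hZ₁.smoothMapOn_diff hh).mdifferentiableAt hU₂ hx₂) X
      have h5 : (fun y => (inner ℝ (ξ y : Euc k) (diff n h y (Z₁ y)) : ℝ)) = fun _ => 0 :=
        funext fun y => inner_diff_eq_zero (hK y (ξ y).2) _
      rw [h5, derivAlong, mfderiv_const] at h4
      rw [secondFF, orthogonalProjectionOnto_normalSpace hK,
        Submodule.inner_orthogonalProjectionOnto_eq_of_mem_left]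
      exact eq_neg_of_add_eq_zero_left h4.symm
    rw [aux hL hf.1 (fun y => (V y).2) hdξ, aux hL' hf'.1 (fun y => τ y (V y).2) hdξ',
      ← hτsff U₂ Z₁ hU₂ hZ₁ x hx₂ X, LinearIsometryEquiv.inner_map_map]
  · have h3 := hτpar U (fun y => (V y).2) hU hV.2 x hx X
    rw [normalConn, normalConn, orthogonalProjectionOnto_normalSpace hL,
      orthogonalProjectionOnto_normalSpace hL'] at h3
    exact h3

/-- For a section `V` of `D`, the maps `f + t V` and `f' + t τ̄V` on `ℝ × M` induce the same metric:
the vectors below are the images of `(s, X)` under their differentials. The nullity of `φ_τ` takes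
care of the components in `L^⊥` and `L'^⊥`. -/
lemma norm_diff_add_eq (hf : IsIsometricImmersion n g f)
    (hf' : IsIsometricImmersion n g f')
    (hL : ∀ x, L x ≤ normalSpace n f x) (hL' : ∀ x, L' x ≤ normalSpace n f' x)
    {τ : ∀ x, L x ≃ₗᵢ[ℝ] L' x} (hτ : SmoothBundleIsometry n τ) (hτpar : IsParallel n f f' τ)
    (hτsff : PreservesSecondFF n f f' τ) {V : ∀ x, SumFibre n L x} {U : Set M} (hU : IsOpen U)
    (hV : SmoothSectionOn n V U) {x : M} (hx : x ∈ U) {Dx : Submodule ℝ (SumFibre n L x)}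
    (hD : V x ∈ Dx) (hnull : IsNull (phiImage n f f' τ x Dx))
    (X : TangentSpace (𝓡 n) x) (t s : ℝ) :
    ‖diff n f x X + t • diff n (ambient n f V) x X + s • ambient n f V x‖ =
      ‖diff n f' x X + t • diff n (ambient n f' (tauBar n τ V)) x X +
        s • ambient n f' (tauBar n τ V) x‖ := by
  refine Intertwined.norm_eq (n := n) hf hf' hL hL' (((intertwined_diff hf hf' hL hL' τ x X).add
    ((intertwined_diff_ambient hf hf' hL hL' hτ hτpar hτsff hU hV hx X).smul t)).add
    ((intertwined_ambient hf hf' hL hL' τ V x).smul s)) ?_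
  have h1 : phi n f f' τ x X V ∈ phiImage n f f' τ x Dx := ⟨X, U, V, hU, hx, hV, hD, rfl⟩
  have h2 := hnull _ h1 _ h1
  rw [real_inner_self_eq_norm_sq, real_inner_self_eq_norm_sq, sub_eq_zero,
    sq_eq_sq₀ (norm_nonneg _) (norm_nonneg _)] at h2
  simp only [map_add, map_smul, starProjection_normalCompl_diff,
    starProjection_normalCompl_ambient, smul_zero, zero_add, add_zero, norm_smul]
  exact congrArg (‖t‖ * ·) h2

end Intertwining

end SubmanifoldGeometry

/-! ### Singular extensions from a chart -/

namespace SubmanifoldGeometry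

section OpenEmbeddingCharts

universe u

variable {k : ℕ} {N : Type u} [TopologicalSpace N] {e : N → Euc k}

/-- A space that embeds as an open subset of Euclidean space is a manifold with one chart. -/
lemma isManifold_singletonChartedSpace (he : Topology.IsOpenEmbedding e) [Nonempty N] :
    letI := he.singletonChartedSpace
    IsManifold (𝓡 k) ∞ N :=
  he.isManifold_singleton

lemma mfderiv_singletonChart_bijective (he : Topology.IsOpenEmbedding e) [Nonempty N] (y : N) :
    letI := he.singletonChartedSpace
    Function.Bijective (mfderiv (𝓡 k) (𝓡 k) e y) := by
  let _ := he.singletonChartedSpace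
  have : IsManifold (𝓡 k) ∞ N := isManifold_singletonChartedSpace he
  have h1 := (mdifferentiable_of_mem_maximalAtlas
    (IsManifold.chart_mem_maximalAtlas (I := 𝓡 k) (n := ∞) y)).mfderiv_bijective
    (mem_chart_source (Euc k) y)
  have h2 : ⇑(chartAt (Euc k) y) = e := he.singletonChartedSpace_chartAt_eq
  rwa [h2] at h1

lemma contMDiff_singletonChart (he : Topology.IsOpenEmbedding e) [Nonempty N] :
    letI := he.singletonChartedSpace
    ContMDiff (𝓡 k) (𝓡 k) ∞ e :=
  contMDiff_isOpenEmbedding he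

lemma diff_comp_singletonChart (he : Topology.IsOpenEmbedding e) [Nonempty N] {m : ℕ}
    {F : Euc k → Euc m} {y : N} {F' : Euc k →L[ℝ] Euc m} (hF : HasFDerivAt F F' (e y)) :
    letI := he.singletonChartedSpace
    ∀ w : TangentSpace (𝓡 k) y,
      diff k (fun z => F (e z)) y w = F' (mfderiv (𝓡 k) (𝓡 k) e y w) := by
  let _ := he.singletonChartedSpace
  intro w
  have h1 := mfderiv_comp y hF.differentiableAt.mdifferentiableAt
    ((contMDiff_singletonChart he y).mdifferentiableAt (by simp))
  rw [mfderiv_eq_fderiv, hF.fderiv] at h1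
  exact congrArg (fun T : TangentSpace (𝓡 k) y →L[ℝ] Euc m => T w) h1

end OpenEmbeddingCharts

lemma inner_map_eq_of_norm_map_eq {W F F' : Type*} [AddCommGroup W] [Module ℝ W]
    [NormedAddCommGroup F] [InnerProductSpace ℝ F] [NormedAddCommGroup F'] [InnerProductSpace ℝ F']
    (A : W →ₗ[ℝ] F) (A' : W →ₗ[ℝ] F') (h : ∀ w, ‖A w‖ = ‖A' w‖) (v w : W) :
    (inner ℝ (A v) (A w) : ℝ) = inner ℝ (A' v) (A' w) := by
  rw [real_inner_eq_norm_add_mul_self_sub_norm_mul_self_sub_norm_mul_self_div_two,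
    real_inner_eq_norm_add_mul_self_sub_norm_mul_self_sub_norm_mul_self_div_two,
    ← map_add, ← map_add, h, h, h]

section SingularExtension

universe u

variable {n p q : ℕ} {M : Type u} [TopologicalSpace M] [ChartedSpace (Euc n) M]
  [IsManifold (𝓡 n) ∞ M]

/-- The part of the domain of the chart `φ` that lies over the open set `O`. -/
def chartPreimage (φ : OpenPartialHomeomorph M (Euc n)) (O : Set (Euc n)) (hO : IsOpen O) :
    TopologicalSpace.Opens M :=
  ⟨φ.source ∩ φ ⁻¹' O, φ.isOpen_inter_preimage hO⟩

/-- The differential of `(u, t) ↦ f u + t • v u`. -/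
lemma hasFDerivAt_add_smul {m : ℕ} {f v : Euc n → Euc m} {u : Euc n}
    (hf : DifferentiableAt ℝ f u) (hv : DifferentiableAt ℝ v u) (t : ℝ) :
    HasFDerivAt (fun z : Euc n × ℝ => f z.1 + z.2 • v z.1)
      ((fderiv ℝ f u + t • fderiv ℝ v u).comp (ContinuousLinearMap.fst ℝ (Euc n) ℝ) +
        (ContinuousLinearMap.snd ℝ (Euc n) ℝ).smulRight (v u)) (u, t) := by
  have h1 : HasFDerivAt (fun z : Euc n × ℝ => f z.1) _ (u, t) :=
    HasFDerivAt.comp (g := f) (u, t) hf.hasFDerivAt hasFDerivAt_fst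
  have h2 : HasFDerivAt (fun z : Euc n × ℝ => v z.1) _ (u, t) :=
    HasFDerivAt.comp (g := v) (u, t) hv.hasFDerivAt hasFDerivAt_fst
  refine (h1.add (hasFDerivAt_snd.smul h2)).congr_fderiv ?_
  ext z <;> simp

/-- Suppose that, over an open set of a chart, `f + t v` and `f' + t v'` induce the same metric and
that `f + t v` is an immersion for small `t ≠ 0`. Then these two maps, defined on an open subset of
`ℝⁿ × ℝ ≃ ℝⁿ⁺¹`, are a singular isometric extension of `f` and `f'`. -/
lemma singularlyExtends_of_add_smul {f : M → Euc (n + p)} {f' : M → Euc (n + q)}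
    {φ : OpenPartialHomeomorph M (Euc n)} (hφ : φ ∈ atlas (Euc n) M)
    {O : Set (Euc n)} (hO : IsOpen O) (hOφ : O ⊆ φ.target) (hne : O.Nonempty) {ε : ℝ} (hε : 0 < ε)
    (hf : ContDiffOn ℝ ∞ (f ∘ φ.symm) O) (hf' : ContDiffOn ℝ ∞ (f' ∘ φ.symm) O)
    {v : Euc n → Euc (n + p)} {v' : Euc n → Euc (n + q)}
    (hv : ContDiffOn ℝ ∞ v O) (hv' : ContDiffOn ℝ ∞ v' O)
    (hnorm : ∀ u ∈ O, ∀ (w : Euc n) (t s : ℝ),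
      ‖fderiv ℝ (f ∘ φ.symm) u w + t • fderiv ℝ v u w + s • v u‖ =
        ‖fderiv ℝ (f' ∘ φ.symm) u w + t • fderiv ℝ v' u w + s • v' u‖)
    (hinj : ∀ u ∈ O, ∀ t : ℝ, t ≠ 0 → |t| < ε → ∀ (w : Euc n) (s : ℝ),
      fderiv ℝ (f ∘ φ.symm) u w + t • fderiv ℝ v u w + s • v u = 0 → w = 0 ∧ s = 0) :
    SingularlyExtends n (fun x : chartPreimage φ O hO => f x)
      (fun x : chartPreimage φ O hO => f' x) := by
  let κ : (Euc n × ℝ) ≃L[ℝ] Euc (n + 1) := ContinuousLinearEquiv.ofFinrankEq (by simp)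
  let Ω : Set (Euc (n + 1)) := κ.symm ⁻¹' (O ×ˢ Set.Ioo (-ε) ε)
  have hΩ : IsOpen Ω := (hO.prod isOpen_Ioo).preimage κ.symm.continuous
  let N : Type u := ULift.{u} Ω
  let e : N → Euc (n + 1) := fun y => (y.down : Euc (n + 1))
  have he : Topology.IsOpenEmbedding e :=
    hΩ.isOpenEmbedding_subtypeVal.comp Homeomorph.ulift.isOpenEmbedding
  have hN : Nonempty N := by
    obtain ⟨u, hu⟩ := hne
    exact ⟨⟨⟨κ (u, 0), by simpa [Ω, hε] using hu⟩⟩⟩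
  let _ : ChartedSpace (Euc (n + 1)) N := he.singletonChartedSpace
  have : IsManifold (𝓡 (n + 1)) ∞ N := isManifold_singletonChartedSpace he
  have hmemO : ∀ y : N, (κ.symm (e y)).1 ∈ O := fun y => y.down.2.1
  have hmemε : ∀ y : N, |(κ.symm (e y)).2| < ε := fun y => abs_lt.2 y.down.2.2
  -- The extension of a map `h` in the direction of `v`.
  let ext : ∀ {m : ℕ}, (M → Euc m) → (Euc n → Euc m) → N → Euc m := fun h v y =>
    (fun z => (h ∘ φ.symm) (κ.symm z).1 + (κ.symm z).2 • v (κ.symm z).1) (e y)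
  have hext : ∀ {m : ℕ} {h : M → Euc m} {v : Euc n → Euc m}, ContDiffOn ℝ ∞ (h ∘ φ.symm) O →
      ContDiffOn ℝ ∞ v O → ContMDiff (𝓡 (n + 1)) 𝓘(ℝ, Euc m) ∞ (ext h v) := by
    intro m h v hh hv
    have hfst : ContDiff ℝ ∞ fun z => (κ.symm z).1 := contDiff_fst.comp κ.symm.contDiff
    have hsnd : ContDiff ℝ ∞ fun z => (κ.symm z).2 := contDiff_snd.comp κ.symm.contDiff
    have h1 : ContDiffOn ℝ ∞
        (fun z => (h ∘ φ.symm) (κ.symm z).1 + (κ.symm z).2 • v (κ.symm z).1) Ω :=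
      (hh.comp hfst.contDiffOn fun z hz => hz.1).add
        (hsnd.contDiffOn.smul (hv.comp hfst.contDiffOn fun z hz => hz.1))
    exact (contMDiffOn_iff_contDiffOn.2 h1).comp_contMDiff (contMDiff_singletonChart he)
      fun y => y.down.2
  have hdiff : ∀ {m : ℕ} {h : M → Euc m} {v : Euc n → Euc m}, ContDiffOn ℝ ∞ (h ∘ φ.symm) O →
      ContDiffOn ℝ ∞ v O → ∀ (y : N) (w : TangentSpace (𝓡 (n + 1)) y),
      diff (n + 1) (ext h v) y w =
        fderiv ℝ (h ∘ φ.symm) (κ.symm (e y)).1 (κ.symm (mfderiv (𝓡 (n + 1)) (𝓡 (n + 1)) e y w)).1 +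
        (κ.symm (e y)).2 •
          fderiv ℝ v (κ.symm (e y)).1 (κ.symm (mfderiv (𝓡 (n + 1)) (𝓡 (n + 1)) e y w)).1 +
        (κ.symm (mfderiv (𝓡 (n + 1)) (𝓡 (n + 1)) e y w)).2 • v (κ.symm (e y)).1 := by
    intro m h v hh hv y w
    have h1 := hasFDerivAt_add_smul
      ((hh.contDiffAt (hO.mem_nhds (hmemO y))).differentiableAt (by simp))
      ((hv.contDiffAt (hO.mem_nhds (hmemO y))).differentiableAt (by simp)) (κ.symm (e y)).2
    have h2 := HasFDerivAt.comp (e y) h1 κ.symm.hasFDerivAt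
    exact diff_comp_singletonChart he h2 w
  have hnormN : ∀ (y : N) (w : TangentSpace (𝓡 (n + 1)) y),
      ‖diff (n + 1) (ext f v) y w‖ = ‖diff (n + 1) (ext f' v') y w‖ := fun y w => by
    rw [hdiff hf hv, hdiff hf' hv']
    exact hnorm _ (hmemO y) _ _ _
  let j : chartPreimage φ O hO → N := fun x =>
    ⟨⟨κ (φ x, 0), by simpa [Ω, hε] using x.2.2⟩⟩
  have hej : ∀ x, e (j x) = κ (φ x, 0) := fun x => rfl
  have hjf : ∀ {m : ℕ} (h : M → Euc m) (v : Euc n → Euc m) (x : chartPreimage φ O hO),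
      ext h v (j x) = h x := by
    intro m h v x
    simp only [ext, hej, ContinuousLinearEquiv.symm_apply_apply, zero_smul, add_zero,
      Function.comp_apply, φ.left_inv x.2.1]
  have hjne : Nonempty (chartPreimage φ O hO) := by
    obtain ⟨u, hu⟩ := hne
    exact ⟨⟨φ.symm u, φ.map_target (hOφ hu), by
      simpa [φ.right_inv (hOφ hu)] using hu⟩⟩
  let ψ : OpenPartialHomeomorph (chartPreimage φ O hO) (Euc n) := φ.subtypeRestr hjne
  have hψ : ∀ x, ψ x = φ x := fun x => rfl
  have hψsource : ψ.source = Set.univ := by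
    rw [φ.subtypeRestr_source]
    exact Set.eq_univ_of_forall fun x => x.2.1
  have hψemb := ψ.isOpenEmbedding hψsource
  have hpair : Topology.IsEmbedding (fun u : Euc n => κ (u, 0)) := by
    refine κ.toHomeomorph.isEmbedding.comp
      (Topology.IsEmbedding.of_leftInverse (f := Prod.fst) (fun u => rfl) continuous_fst ?_)
    exact continuous_id.prodMk continuous_const
  have hejemb : Topology.IsEmbedding (e ∘ j) := hpair.comp hψemb.isEmbedding
  have hjc : Continuous j := he.isInducing.continuous_iff.2 hejemb.continuous
  have hjemb : Manifold.IsSmoothEmbedding (𝓡 n) (𝓡 (n + 1)) ∞ j := by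
    refine ⟨Manifold.IsImmersionOfComplement.isImmersion (F := ℝ) fun x => ?_,
      Topology.IsEmbedding.of_comp hjc he.continuous hejemb⟩
    refine Manifold.IsImmersionAtOfComplement.mk_of_continuousAt hjc.continuousAt κ ψ
      (chartAt (Euc (n + 1)) (j x)) (by rw [hψsource]; trivial) (mem_chart_source _ _)
      (StructureGroupoid.subtypeRestr_mem_maximalAtlas hφ hjne)
      (IsManifold.chart_mem_maximalAtlas _) fun u hu => ?_
    have hu' : u ∈ ψ.target := by simpa using hu
    have h1 : ⇑(chartAt (Euc (n + 1)) (j x)) = e := he.singletonChartedSpace_chartAt_eq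
    simp only [Function.comp_apply, OpenPartialHomeomorph.extend_coe,
      OpenPartialHomeomorph.extend_coe_symm, h1]
    change e (j (ψ.symm u)) = κ (u, 0)
    rw [hej, ← hψ, ψ.right_inv hu']
  refine ⟨1, one_pos, N, inferInstance, he.isEmbedding.t2Space,
    he.isEmbedding.secondCountableTopology, inferInstance, inferInstance, j, ext f v, ext f' v',
    hjemb, hext hf hv, hext hf' hv', fun y a b => ?_, funext fun x => (hjf f v x).symm,
    funext fun x => (hjf f' v' x).symm, fun y hy => ?_⟩
  · exact inner_map_eq_of_norm_map_eq (diff (n + 1) (ext f v) y).toLinearMap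
      (diff (n + 1) (ext f' v') y).toLinearMap (hnormN y) a b
  · have ht : (κ.symm (e y)).2 ≠ 0 := by
      intro ht
      refine hy ⟨⟨φ.symm (κ.symm (e y)).1, φ.map_target (hOφ (hmemO y)), ?_⟩, ?_⟩
      · simpa [φ.right_inv (hOφ (hmemO y))] using hmemO y
      · refine he.injective ?_
        rw [hej, φ.right_inv (hOφ (hmemO y)), ← ht]
        exact κ.apply_symm_apply _
    have key : ∀ w : TangentSpace (𝓡 (n + 1)) y, diff (n + 1) (ext f v) y w = 0 → w = 0 := by
      intro w hw
      rw [hdiff hf hv] at hw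
      obtain ⟨h1, h2⟩ := hinj _ (hmemO y) _ ht (hmemε y) _ _ hw
      have h3 : κ.symm (mfderiv (𝓡 (n + 1)) (𝓡 (n + 1)) e y w) = 0 := Prod.ext h1 h2
      have h4 : mfderiv (𝓡 (n + 1)) (𝓡 (n + 1)) e y w = 0 :=
        κ.symm.injective (h3.trans (map_zero κ.symm).symm)
      exact (mfderiv_singletonChart_bijective he y).1 (h4.trans (map_zero _).symm)
    refine ⟨(injective_iff_map_eq_zero _).2 key, (injective_iff_map_eq_zero _).2 fun w hw => ?_⟩
    refine key w ?_
    rw [← norm_eq_zero, hnormN, hw, norm_zero]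

end SingularExtension

end SubmanifoldGeometry

/-! ### Degeneracy of `f + t V` -/

namespace SubmanifoldGeometry

section Degeneracy

universe u

variable {n : ℕ} {M : Type u} [TopologicalSpace M] [ChartedSpace (Euc n) M]
  [IsManifold (𝓡 n) ∞ M]

lemma SmoothSectionOn.smoothMapOn_ambient {m : ℕ} {f : M → Euc m}
    (hf : ContMDiff (𝓡 n) 𝓘(ℝ, Euc m) ∞ f) {L : M → Submodule ℝ (Euc m)}
    {V : ∀ x, SumFibre n L x} {U : Set M} (hV : SmoothSectionOn n V U) :
    SmoothMapOn n (ambient n f V) U :=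
  ContMDiffOn.add (hV.1.smoothMapOn_diff hf) hV.2

lemma SmoothSectionOn.tauBar {m m' : ℕ} {L : M → Submodule ℝ (Euc m)}
    {L' : M → Submodule ℝ (Euc m')} {τ : ∀ x, L x ≃ₗᵢ[ℝ] L' x} (hτ : SmoothBundleIsometry n τ)
    {V : ∀ x, SumFibre n L x} {U : Set M} (hU : IsOpen U) (hV : SmoothSectionOn n V U) :
    SmoothSectionOn n (tauBar n τ V) U :=
  ⟨hV.1, hτ U (fun x => (V x).2) hU hV.2⟩

variable {p q : ℕ} {g : RiemMetric n M} {f : M → Euc (n + p)} {f' : M → Euc (n + q)}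
  {L : M → Submodule ℝ (Euc (n + p))} {L' : M → Submodule ℝ (Euc (n + q))}

/-- If `f'` is a strongly genuine deformation of `f`, then for every section `V` of `D` the map
`f + t V` is nowhere an immersion on `ℝ × M`: otherwise, by `exists_open_injective_pencil`, it would
be an immersion for small `t ≠ 0` over some nonempty open set, and so together with `f' + t τ̄V` it
would be a singular isometric extension there. -/
lemma exists_mem_ker_of_stronglyGenuine (hf : IsIsometricImmersion n g f)
    (hf' : IsIsometricImmersion n g f') (hgen : StronglyGenuine n f f')
    (hL : ∀ x, L x ≤ normalSpace n f x) (hL' : ∀ x, L' x ≤ normalSpace n f' x)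
    {τ : ∀ x, L x ≃ₗᵢ[ℝ] L' x} (hτ : SmoothBundleIsometry n τ) (hτpar : IsParallel n f f' τ)
    (hτsff : PreservesSecondFF n f f' τ) {D : ∀ x, Submodule ℝ (SumFibre n L x)}
    (hnull : ∀ x, IsNull (phiImage n f f' τ x (D x)))
    {V : ∀ x, SumFibre n L x} {U : Set M} (hU : IsOpen U)
    (hV : SmoothSectionOn n V U) (hVD : ∀ x ∈ U, V x ∈ D x) {x : M} (hx : x ∈ U) (t : ℝ) :
    ∃ (X : TangentSpace (𝓡 n) x) (s : ℝ), (X ≠ 0 ∨ s ≠ 0) ∧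
      diff n f x X + t • diff n (ambient n f V) x X + s • ambient n f V x = 0 := by
  by_contra! hcon
  let φ := chartAt (Euc n) x
  have hφ : φ ∈ IsManifold.maximalAtlas (𝓡 n) ∞ M := IsManifold.chart_mem_maximalAtlas x
  have hxs : x ∈ φ.source := mem_chart_source _ x
  let O : Set (Euc n) := φ.target ∩ φ.symm ⁻¹' U
  have hO : IsOpen O := φ.isOpen_inter_preimage_symm hU
  have hfm : ∀ y, MDifferentiableAt (𝓡 n) 𝓘(ℝ, Euc (n + p)) f y := fun y =>
    hf.1.contMDiffAt.mdifferentiableAt (by simp)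
  have hfm' : ∀ y, MDifferentiableAt (𝓡 n) 𝓘(ℝ, Euc (n + q)) f' y := fun y =>
    hf'.1.contMDiffAt.mdifferentiableAt (by simp)
  have hVs := hV.smoothMapOn_ambient hf.1
  have hVs' := (hV.tauBar hτ hU).smoothMapOn_ambient hf'.1
  let v : Euc n → Euc (n + p) := ambient n f V ∘ φ.symm
  let v' : Euc n → Euc (n + q) := ambient n f' (tauBar n τ V) ∘ φ.symm
  have hv : ContDiffOn ℝ ∞ v O := hVs.contDiffOn_chart hφ
  have hv' : ContDiffOn ℝ ∞ v' O := hVs'.contDiffOn_chart hφ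
  have hfO : ContDiffOn ℝ ∞ (f ∘ φ.symm) O :=
    SmoothMapOn.contDiffOn_chart hφ (U := U) hf.1.contMDiffOn
  have hfO' : ContDiffOn ℝ ∞ (f' ∘ φ.symm) O :=
    SmoothMapOn.contDiffOn_chart hφ (U := U) hf'.1.contMDiffOn
  have htrans : ∀ u ∈ O, ∀ (w : Euc n) (t s : ℝ),
      fderiv ℝ (f ∘ φ.symm) u w + t • fderiv ℝ v u w + s • v u =
        diff n f (φ.symm u) (chartFrame φ u w) +
          t • diff n (ambient n f V) (φ.symm u) (chartFrame φ u w) +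
          s • ambient n f V (φ.symm u) := by
    intro u hu w t s
    rw [diff_chartFrame hφ hu.1 (hfm _), diff_chartFrame hφ hu.1 (hVs.mdifferentiableAt hU hu.2)]
    rfl
  have htrans' : ∀ u ∈ O, ∀ (w : Euc n) (t s : ℝ),
      fderiv ℝ (f' ∘ φ.symm) u w + t • fderiv ℝ v' u w + s • v' u =
        diff n f' (φ.symm u) (chartFrame φ u w) +
          t • diff n (ambient n f' (tauBar n τ V)) (φ.symm u) (chartFrame φ u w) +
          s • ambient n f' (tauBar n τ V) (φ.symm u) := by
    intro u hu w t s
    rw [diff_chartFrame hφ hu.1 (hfm' _),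
      diff_chartFrame hφ hu.1 (hVs'.mdifferentiableAt hU hu.2)]
    rfl
  let A : O → Euc n × ℝ →L[ℝ] Euc (n + p) := fun u =>
    (fderiv ℝ (f ∘ φ.symm) u).comp (ContinuousLinearMap.fst ℝ (Euc n) ℝ) +
      (ContinuousLinearMap.snd ℝ (Euc n) ℝ).smulRight (v u)
  let B : O → Euc n × ℝ →L[ℝ] Euc (n + p) := fun u =>
    (fderiv ℝ v u).comp (ContinuousLinearMap.fst ℝ (Euc n) ℝ)
  have hAB : ∀ (u : O) (t : ℝ) (z : Euc n × ℝ), (A u + t • B u) z =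
      fderiv ℝ (f ∘ φ.symm) u z.1 + t • fderiv ℝ v u z.1 + z.2 • v u := by
    intro u t z
    simp [A, B]
    abel
  have hfderiv : ∀ {h : Euc n → Euc (n + p)}, ContDiffOn ℝ ∞ h O →
      Continuous fun u : O => fderiv ℝ h u := fun hh =>
    continuousOn_iff_continuous_domRestrict.1 (hh.continuousOn_fderiv_of_isOpen hO (by simp))
  have hB : Continuous B := (hfderiv hv).clm_comp continuous_const
  have hA : Continuous A := by
    refine ((hfderiv hfO).clm_comp continuous_const).add ?_
    exact (ContinuousLinearMap.smulRightL ℝ (Euc n × ℝ) (Euc (n + p))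
      (ContinuousLinearMap.snd ℝ (Euc n) ℝ)).continuous.comp
      (continuousOn_iff_continuous_domRestrict.1 hv.continuousOn)
  have hxO : φ x ∈ O := ⟨φ.map_source hxs, by
    change φ.symm (φ x) ∈ U
    rwa [φ.left_inv hxs]⟩
  have hinj : Function.Injective (A ⟨φ x, hxO⟩ + t • B ⟨φ x, hxO⟩) := by
    refine (injective_iff_map_eq_zero _).2 fun z hz => ?_
    rw [hAB, htrans _ hxO] at hz
    have hcon' : ∀ (y : M), y = x → ∀ (X : TangentSpace (𝓡 n) y) (s : ℝ),
        diff n f y X + t • diff n (ambient n f V) y X + s • ambient n f V y = 0 →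
          X = 0 ∧ s = 0 := by
      rintro y rfl X s h0
      by_contra hne
      refine hcon X s ?_ h0
      by_contra! h2
      exact hne h2
    obtain ⟨h1, h2⟩ := hcon' _ (φ.left_inv hxs) _ _ hz
    exact Prod.ext ((chartFrame_bijective hφ hxO.1).1 (h1.trans (map_zero _).symm)) h2
  obtain ⟨W, hWo, ⟨u₀, hu₀⟩, ε, hε, hW⟩ := exists_open_injective_pencil A B hA hB hinj
  have hWo' : IsOpen (Subtype.val '' W : Set (Euc n)) := hO.isOpenMap_subtype_val W hWo
  have hWO : (Subtype.val '' W : Set (Euc n)) ⊆ O := by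
    rintro _ ⟨u, -, rfl⟩
    exact u.2
  refine hgen (chartPreimage φ _ hWo') ⟨φ.symm u₀, φ.map_target u₀.2.1, ?_⟩
    (singularlyExtends_of_add_smul (chart_mem_atlas _ x) hWo' (fun u hu => (hWO hu).1)
      ⟨u₀, u₀, hu₀, rfl⟩ hε (hfO.mono hWO) (hfO'.mono hWO) (hv.mono hWO) (hv'.mono hWO) ?_ ?_)
  · change φ (φ.symm u₀) ∈ (Subtype.val '' W : Set (Euc n))
    rw [φ.right_inv u₀.2.1]
    exact ⟨u₀, hu₀, rfl⟩
  · intro u hu w t s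
    rw [htrans u (hWO hu), htrans' u (hWO hu)]
    exact norm_diff_add_eq hf hf' hL hL' hτ hτpar hτsff hU hV (hWO hu).2 (hVD _ (hWO hu).2)
      (hnull _) _ t s
  · rintro _ ⟨u, hu, rfl⟩ t ht htε w s h0
    rw [← hAB u t (w, s)] at h0
    have h1 := (injective_iff_map_eq_zero _).1 (hW u hu t ht htε) _ h0
    exact ⟨congrArg Prod.fst h1, congrArg Prod.snd h1⟩

lemma IsIsometricImmersion.diff_injective {m : ℕ} {f : M → Euc m}
    (hf : IsIsometricImmersion n g f) (x : M) : Function.Injective (diff n f x) := by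
  refine (injective_iff_map_eq_zero _).2 fun X hX => ?_
  by_contra hne
  have h1 := g.pos x X hne
  rw [← hf.2, hX, inner_zero_left] at h1
  exact lt_irrefl _ h1

end Degeneracy

end SubmanifoldGeometry

/-! ### Charts given by a local diffeomorphism -/

namespace SubmanifoldGeometry

section GraphCharts

universe u

variable {n : ℕ} {M : Type u} [TopologicalSpace M] [ChartedSpace (Euc n) M]

lemma mem_contDiffGroupoid_of_contDiffOn {ψ : OpenPartialHomeomorph (Euc n) (Euc n)}
    (h : ContDiffOn ℝ ∞ ψ ψ.source) (h' : ContDiffOn ℝ ∞ ψ.symm ψ.target) :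
    ψ ∈ contDiffGroupoid ∞ (𝓡 n) := by
  rw [contDiffGroupoid, mem_groupoid_of_pregroupoid]
  constructor
  · simpa [contDiffPregroupoid] using h
  · simpa [contDiffPregroupoid] using h'

lemma trans_mem_maximalAtlas {φ : OpenPartialHomeomorph M (Euc n)}
    (hφ : φ ∈ IsManifold.maximalAtlas (𝓡 n) ∞ M) {ψ : OpenPartialHomeomorph (Euc n) (Euc n)}
    (hψ : ψ ∈ contDiffGroupoid ∞ (𝓡 n)) :
    φ.trans ψ ∈ IsManifold.maximalAtlas (𝓡 n) ∞ M := by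
  set G := contDiffGroupoid ∞ (𝓡 n) with hG
  change φ.trans ψ ∈ G.maximalAtlas M
  rw [mem_maximalAtlas_iff]
  intro e he
  obtain ⟨h1, h2⟩ := mem_maximalAtlas_iff.1 hφ e he
  constructor
  · rw [OpenPartialHomeomorph.trans_symm_eq_symm_trans_symm, OpenPartialHomeomorph.trans_assoc]
    exact G.trans (G.symm hψ) h1
  · rw [← OpenPartialHomeomorph.trans_assoc]
    exact G.trans h2 hψ

variable [IsManifold (𝓡 n) ∞ M]

/-- A smooth map to the model space with bijective differential at `x` restricts to a chart
around `x`. -/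
lemma exists_chart_of_mfderiv_bijective {h : M → Euc n} (hh : ContMDiff (𝓡 n) 𝓘(ℝ, Euc n) ∞ h)
    {x : M} (hx : Function.Bijective (diff n h x)) :
    ∃ φ ∈ IsManifold.maximalAtlas (𝓡 n) ∞ M, x ∈ φ.source ∧ ∀ y ∈ φ.source, φ y = h y := by
  obtain ⟨φ, hφ, u, hu, rfl⟩ := exists_chart_symm_eq (n := n) x
  have hk : ContDiffOn ℝ ∞ (h ∘ φ.symm) φ.target := by
    have := SmoothMapOn.contDiffOn_chart (n := n) hφ (U := Set.univ) (h := h) hh.contMDiffOn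
    simpa using this
  have hkat : ∀ v ∈ φ.target, ContDiffAt ℝ ∞ (h ∘ φ.symm) v := fun v hv =>
    hk.contDiffAt (φ.open_target.mem_nhds hv)
  have hdh : ∀ v ∈ φ.target, MDifferentiableAt (𝓡 n) 𝓘(ℝ, Euc n) h (φ.symm v) := fun v _ =>
    hh.contMDiffAt.mdifferentiableAt (by simp)
  let A : Set (Euc n) := φ.target ∩
    fderiv ℝ (h ∘ φ.symm) ⁻¹' Set.range (fun e : Euc n ≃L[ℝ] Euc n => (e : Euc n →L[ℝ] Euc n))
  have hA : IsOpen A :=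
    (hk.continuousOn_fderiv_of_isOpen φ.open_target (by simp)).isOpen_inter_preimage
      φ.open_target ContinuousLinearEquiv.isOpen
  have huA : u ∈ A := by
    refine ⟨hu, ?_⟩
    have hb : Function.Bijective (fderiv ℝ (h ∘ φ.symm) u) := by
      have h1 : ⇑(fderiv ℝ (h ∘ φ.symm) u) = diff n h (φ.symm u) ∘ chartFrame φ u := by
        funext w
        exact (diff_chartFrame hφ hu (hdh u hu) w).symm
      rw [h1]
      exact hx.comp (chartFrame_bijective hφ hu)
    exact ⟨(LinearEquiv.ofBijective (fderiv ℝ (h ∘ φ.symm) u : Euc n →ₗ[ℝ] Euc n)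
      hb).toContinuousLinearEquiv, rfl⟩
  obtain ⟨T, hT : (T : Euc n →L[ℝ] Euc n) = fderiv ℝ (h ∘ φ.symm) u⟩ := huA.2
  have hTd : HasFDerivAt (h ∘ φ.symm) (T : Euc n →L[ℝ] Euc n) u := by
    rw [hT]
    exact ((hkat u hu).differentiableAt (by simp)).hasFDerivAt
  let ψ₀ := (hkat u hu).toOpenPartialHomeomorph (h ∘ φ.symm) hTd (by simp)
  have hψ₀ : ⇑ψ₀ = h ∘ φ.symm := (hkat u hu).toOpenPartialHomeomorph_coe hTd (by simp)
  let ψ := ψ₀.restrOpen A hA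
  have hψ : ⇑ψ = h ∘ φ.symm := hψ₀
  have hψs : ψ.source ⊆ A := fun v hv => by
    have : v ∈ ψ₀.source ∩ A := by simpa [ψ] using hv
    exact this.2
  have huψ : u ∈ ψ.source := by
    have : u ∈ ψ₀.source ∩ A :=
      ⟨(hkat u hu).mem_toOpenPartialHomeomorph_source hTd (by simp), huA⟩
    simpa [ψ] using this
  have hψg : ψ ∈ contDiffGroupoid ∞ (𝓡 n) := by
    refine mem_contDiffGroupoid_of_contDiffOn ?_ fun c hc => ?_
    · rw [hψ]
      exact hk.mono fun v hv => (hψs hv).1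
    · have hv := hψs (ψ.map_target hc)
      obtain ⟨T', hT' : (T' : Euc n →L[ℝ] Euc n) = fderiv ℝ (h ∘ φ.symm) (ψ.symm c)⟩ := hv.2
      refine (ψ.contDiffAt_symm (f₀' := T') hc ?_ ?_).contDiffWithinAt
      · rw [hψ, hT']
        exact ((hkat _ hv.1).differentiableAt (by simp)).hasFDerivAt
      · rw [hψ]
        exact hkat _ hv.1
  refine ⟨φ.trans ψ, trans_mem_maximalAtlas hφ hψg, ?_, fun y hy => ?_⟩
  · rw [OpenPartialHomeomorph.trans_source]
    refine ⟨φ.map_target hu, ?_⟩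
    rw [Set.mem_preimage, φ.right_inv hu]
    exact huψ
  · rw [OpenPartialHomeomorph.trans_source] at hy
    rw [OpenPartialHomeomorph.coe_trans, hψ, Function.comp_apply, Function.comp_apply,
      φ.left_inv hy.1]

end GraphCharts

end SubmanifoldGeometry

/-! ### Rulings as totally geodesic submanifolds -/

namespace SubmanifoldGeometry

section Rulings

universe u

lemma exists_leftInverse_clm {k m : ℕ} (E : Euc k →L[ℝ] Euc m) (hE : Function.Injective E) :
    ∃ Λ : Euc m →L[ℝ] Euc k, ∀ c, Λ (E c) = c := by
  obtain ⟨Λ, hΛ⟩ := E.toLinearMap.exists_leftInverse_of_injective (LinearMap.ker_eq_bot.2 hE)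
  exact ⟨Λ.toContinuousLinearMap, fun c => congrArg (fun T : Euc k →ₗ[ℝ] Euc k => T c) hΛ⟩

lemma mapsToAffine_of_parametrization {d m : ℕ} {M : Type u} {f : M → Euc m} {x₀ : M}
    {E : Euc d →L[ℝ] Euc m}
    (hE : Function.Injective E) {γ : Euc d → M} {ε : ℝ}
    (hγ : ∀ c, ‖c‖ < ε → f (γ c) = f x₀ + E c) :
    MapsToAffine f d (γ '' Metric.ball 0 ε) := by
  obtain ⟨Λ, hΛ⟩ := exists_leftInverse_clm E hE
  refine ⟨AffineSubspace.mk' (f x₀) (LinearMap.range E.toLinearMap),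
    {z | ‖Λ (z - f x₀)‖ < ε}, ?_, ?_, ?_⟩
  · rw [AffineSubspace.direction_mk', LinearMap.finrank_range_of_inj hE, finrank_euclideanSpace,
      Fintype.card_fin]
  · exact isOpen_lt (by fun_prop) continuous_const
  · ext z
    constructor
    · rintro ⟨_, ⟨c, hc, rfl⟩, rfl⟩
      have hc' : ‖c‖ < ε := by simpa using hc
      rw [hγ c hc']
      refine ⟨?_, ?_⟩
      · rw [SetLike.mem_coe, AffineSubspace.mem_mk']
        exact ⟨c, by simp⟩
      · simpa [hΛ] using hc'
    · rintro ⟨hz, hzO⟩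
      rw [SetLike.mem_coe, AffineSubspace.mem_mk'] at hz
      obtain ⟨c, hc⟩ := hz
      have hc1 : z - f x₀ = E c := hc.symm
      have hc2 : ‖c‖ < ε := by
        have : ‖Λ (z - f x₀)‖ < ε := hzO
        rwa [hc1, hΛ] at this
      exact ⟨γ c, ⟨c, by simpa using hc2, rfl⟩, by rw [hγ c hc2, ← hc1]; abel⟩

variable {n d : ℕ} {M : Type u} [TopologicalSpace M] [ChartedSpace (Euc n) M]
  [IsManifold (𝓡 n) ∞ M]

/-- Let `S` be parametrized, in a chart, by a ball in an affine subspace. Suppose that `f` and `f'`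
are injective affine maps in this parametrization, with linear parts `E` and `E'`. Then `S` is an
embedded totally geodesic submanifold, because `f_* T S` is the constant subspace `range E`. -/
lemma exists_ruling_submanifold {g : RiemMetric n M} {m m' : ℕ} {f : M → Euc m} {f' : M → Euc m'}
    (hf : IsIsometricImmersion n g f) {x₀ : M} {φ : OpenPartialHomeomorph M (Euc n)}
    (hφ : φ ∈ IsManifold.maximalAtlas (𝓡 n) ∞ M) (hx₀ : x₀ ∈ φ.source)
    {Θ : Euc d →L[ℝ] Euc n} {E : Euc d →L[ℝ] Euc m} {E' : Euc d →L[ℝ] Euc m'}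
    (hΘ : Function.Injective Θ) (hE : Function.Injective E) (hE' : Function.Injective E')
    {ε : ℝ} (hε : 0 < ε) (hφt : ∀ c, ‖c‖ < ε → φ x₀ + Θ c ∈ φ.target)
    (hfγ : ∀ c, ‖c‖ < ε → f (φ.symm (φ x₀ + Θ c)) = f x₀ + E c)
    (hfγ' : ∀ c, ‖c‖ < ε → f' (φ.symm (φ x₀ + Θ c)) = f' x₀ + E' c) :
    ∃ (S : Set M) (_ : ChartedSpace (Euc d) S) (_ : IsManifold (𝓡 d) ∞ S) (hx : x₀ ∈ S),
      Manifold.IsSmoothEmbedding (𝓡 d) (𝓡 n) ∞ (Subtype.val : S → M) ∧ IsPreconnected S ∧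
      IsTotallyGeodesic n g d S ∧
      tangentOf n d S ⟨x₀, hx⟩ =
        (LinearMap.range E.toLinearMap).comap (diff n f x₀).toLinearMap ∧
      MapsToAffine f d S ∧ MapsToAffine f' d S := by
  let γ : Euc d → M := fun c => φ.symm (φ x₀ + Θ c)
  let S : Set M := γ '' Metric.ball 0 ε
  obtain ⟨Λ, hΛ⟩ := exists_leftInverse_clm E hE
  have hball : ∀ {c : Euc d}, c ∈ Metric.ball (0 : Euc d) ε ↔ ‖c‖ < ε := by simp
  have hγ0 : γ 0 = x₀ := by simp [γ, φ.left_inv hx₀]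
  have hxS : x₀ ∈ S := ⟨0, by simpa using hε, hγ0⟩
  have hγc : ContinuousOn γ (Metric.ball 0 ε) := by
    refine φ.continuousOn_symm.comp (by fun_prop) fun c hc => hφt c (hball.1 hc)
  -- The global chart of `S`.
  let e : S → Euc d := fun s => Λ (f s - f x₀)
  have heγ : ∀ c (hc : c ∈ Metric.ball (0 : Euc d) ε), e ⟨γ c, c, hc, rfl⟩ = c := by
    intro c hc
    change Λ (f (γ c) - f x₀) = c
    rw [hfγ c (hball.1 hc), add_sub_cancel_left, hΛ]
  have hemem : ∀ s : S, e s ∈ Metric.ball (0 : Euc d) ε := by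
    rintro ⟨_, c, hc, rfl⟩
    rw [heγ c hc]; exact hc
  have hγe : ∀ s : S, γ (e s) = s := by
    rintro ⟨_, c, hc, rfl⟩
    rw [heγ c hc]
  let H : S ≃ₜ Metric.ball (0 : Euc d) ε :=
    { toFun := fun s => ⟨e s, hemem s⟩
      invFun := fun c => ⟨γ c, c, c.2, rfl⟩
      left_inv := fun s => Subtype.ext (hγe s)
      right_inv := fun c => Subtype.ext (heγ c c.2)
      continuous_toFun := by
        have hfc : Continuous f := hf.1.continuous
        exact Continuous.subtype_mk (by fun_prop) _
      continuous_invFun :=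
        (continuousOn_iff_continuous_domRestrict.1 hγc).subtype_mk _ }
  have he : Topology.IsOpenEmbedding e :=
    Metric.isOpen_ball.isOpenEmbedding_subtypeVal.comp H.isOpenEmbedding
  have hSne : Nonempty S := ⟨⟨x₀, hxS⟩⟩
  let _ : ChartedSpace (Euc d) S := he.singletonChartedSpace
  have hSm : IsManifold (𝓡 d) ∞ S := isManifold_singletonChartedSpace he
  have hemb : Manifold.IsSmoothEmbedding (𝓡 d) (𝓡 n) ∞ (Subtype.val : S → M) := by
    let κ : (Euc d × (LinearMap.range Θ.toLinearMap)ᗮ) ≃L[ℝ] Euc n :=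
      (((LinearEquiv.ofInjective Θ.toLinearMap hΘ).prodCongr (LinearEquiv.refl ℝ _)).trans
        (Submodule.prodEquivOfIsCompl _ _
          (Submodule.isCompl_orthogonal (LinearMap.range Θ.toLinearMap)))).toContinuousLinearEquiv
    have hκ : ∀ c, κ (c, 0) = Θ c := fun c => by simp [κ]
    let ψ : OpenPartialHomeomorph (Euc n) (Euc n) :=
      (Homeomorph.subRight (φ x₀)).toOpenPartialHomeomorph
    have hψ : ψ ∈ contDiffGroupoid ∞ (𝓡 n) :=
      mem_contDiffGroupoid_of_contDiffOn (contDiff_id.sub contDiff_const).contDiffOn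
        (contDiff_id.add contDiff_const).contDiffOn
    refine ⟨Manifold.IsImmersionOfComplement.isImmersion
      (F := (LinearMap.range Θ.toLinearMap)ᗮ) fun s => ?_, Topology.IsEmbedding.subtypeVal⟩
    refine Manifold.IsImmersionAtOfComplement.mk_of_continuousAt
      continuous_subtype_val.continuousAt κ (chartAt (Euc d) s) (φ.trans ψ)
      (mem_chart_source _ _) ?_ (IsManifold.chart_mem_maximalAtlas _)
      (trans_mem_maximalAtlas hφ hψ) fun c hc => ?_
    · rw [← hγe s]
      simpa [ψ] using φ.map_target (hφt _ (hball.1 (hemem s)))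
    · have hc' : c ∈ (chartAt (Euc d) s).target := by simpa using hc
      have h1 : ⇑(chartAt (Euc d) s) = e := he.singletonChartedSpace_chartAt_eq
      have h2 : e ((chartAt (Euc d) s).symm c) = c := by
        rw [← h1]; exact (chartAt (Euc d) s).right_inv hc'
      simp only [Function.comp_apply, OpenPartialHomeomorph.extend_coe,
        OpenPartialHomeomorph.extend_coe_symm]
      change φ ((chartAt (Euc d) s).symm c : M) - φ x₀ = κ (c, 0)
      rw [← hγe, h2, hκ]
      have h3 : ‖c‖ < ε := by rw [← h2]; exact hball.1 (hemem _)
      change φ (φ.symm (φ x₀ + Θ c)) - φ x₀ = Θ c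
      rw [φ.right_inv (hφt c h3), add_sub_cancel_left]
  have hval : ∀ s : S, MDifferentiableAt (𝓡 d) (𝓡 n) (Subtype.val : S → M) s := fun s =>
    hemb.contMDiff.contMDiffAt.mdifferentiableAt (by simp)
  -- The chain rule for the restriction of a map to `S`.
  have hchain : ∀ {k : ℕ} {a : M → Euc k} (s : S),
      MDifferentiableAt (𝓡 n) 𝓘(ℝ, Euc k) a (s : M) → ∀ w : TangentSpace (𝓡 d) s,
      diff n a (s : M) (mfderiv (𝓡 d) (𝓡 n) (Subtype.val : S → M) s w) =
        diff d (fun s : S => a s) s w := by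
    intro k a s ha w
    exact (congrArg (fun T : TangentSpace (𝓡 d) s →L[ℝ] Euc k => T w)
      (mfderiv_comp s ha (hval s))).symm
  have hfe : (fun s : S => f s) = fun s => f x₀ + E (e s) := by
    funext s
    conv_lhs => rw [← hγe s]
    exact hfγ _ (hball.1 (hemem s))
  have htan : ∀ (s : S) (w : TangentSpace (𝓡 d) s),
      diff n f (s : M) (mfderiv (𝓡 d) (𝓡 n) (Subtype.val : S → M) s w) =
        E (mfderiv (𝓡 d) (𝓡 d) e s w) := by
    intro s w
    rw [hchain s (hf.1.contMDiffAt.mdifferentiableAt (by simp)), hfe]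
    exact diff_comp_singletonChart he (F := fun c => f x₀ + E c)
      (E.hasFDerivAt.const_add (f x₀)) w
  have hsurj : ∀ (s : S) (c : Euc d), ∃ w : TangentSpace (𝓡 d) s,
      mfderiv (𝓡 d) (𝓡 d) e s w = c := fun s => (mfderiv_singletonChart_bijective he s).2
  refine ⟨S, inferInstance, hSm, hxS, hemb, ?_, ?_, ?_,
    mapsToAffine_of_parametrization hE hfγ, mapsToAffine_of_parametrization hE' hfγ'⟩
  · exact (convex_ball (0 : Euc d) ε).isPreconnected.image γ hγc
  · intro U X Y Z hU hX hY hZ hXY s hs hZs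
    rw [innerLeviCivita_eq hf hU hX hY hZ hs]
    have hdY := (hY.smoothMapOn_diff hf.1).mdifferentiableAt hU hs
    set ν := diff n f s (Z s) with hν
    have hνE : ∀ c, (inner ℝ (E c) ν : ℝ) = 0 := by
      intro c
      obtain ⟨w, rfl⟩ := hsurj s c
      rw [← htan, hν, real_inner_comm, hf.2]
      exact hZs _ ⟨w, rfl⟩
    obtain ⟨w, hw⟩ := (hXY s hs).1
    rw [← hw]
    change (inner ℝ (diff n (fun y => diff n f y (Y y)) (s : M)
      (mfderiv (𝓡 d) (𝓡 n) (Subtype.val : S → M) s w)) ν : ℝ) = 0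
    rw [hchain s hdY]
    have hdS : MDifferentiableAt (𝓡 d) 𝓘(ℝ, Euc m)
        (fun s : S => diff n f s (Y s)) s := hdY.comp s (hval s)
    have h1 := derivAlong_inner (n := d) hdS
      (mdifferentiableAt_const (I := 𝓡 d) (I' := 𝓘(ℝ, Euc m)) (c := ν)) w
    have h2 : (fun y : S => (inner ℝ (diff n f y (Y y)) ν : ℝ)) =ᶠ[𝓝 s] fun _ => 0 := by
      filter_upwards [(hU.preimage continuous_subtype_val).mem_nhds hs] with y hy
      obtain ⟨w', hw'⟩ := (hXY y hy).2
      rw [← hw']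
      exact (congrArg (fun z => (inner ℝ z ν : ℝ)) (htan y w')).trans (hνE _)
    have h3 : derivAlong d (fun y : S => (inner ℝ (diff n f y (Y y)) ν : ℝ)) s w = 0 := by
      rw [derivAlong, h2.mfderiv_eq, mfderiv_const]; rfl
    have h4 : diff d (fun _ : S => ν) s w = 0 := by
      rw [diff, mfderiv_const]; rfl
    rw [h3, h4, inner_zero_right, add_zero] at h1
    exact h1.symm
  · ext X
    rw [Submodule.mem_comap]
    constructor
    · rintro ⟨w, rfl⟩
      exact ⟨_, (htan ⟨x₀, hxS⟩ w).symm⟩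
    · rintro ⟨c, hc⟩
      obtain ⟨w, hw⟩ := hsurj ⟨x₀, hxS⟩ c
      refine ⟨w, hf.diff_injective x₀ ?_⟩
      refine (htan ⟨x₀, hxS⟩ w).trans ?_
      rw [hw]
      exact hc

end Rulings

end SubmanifoldGeometry

/-! ### Frames of `D` and the rulings they generate -/

namespace SubmanifoldGeometry

section Combinations

universe u

variable {n d : ℕ} {M : Type u} [TopologicalSpace M] [ChartedSpace (Euc n) M]
  {m m' : ℕ} {L : M → Submodule ℝ (Euc m)} {L' : M → Submodule ℝ (Euc m')}

/-- The section `∑ i, c i • V i`, for a finite family `V` of sections of `TM ⊕ L`. -/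
noncomputable def combination (V : Fin d → ∀ y, SumFibre n L y) (c : Euc d) (y : M) :
    SumFibre n L y :=
  ∑ i, c i • V i y

lemma combination_mem_span (V : Fin d → ∀ y, SumFibre n L y) (c : Euc d) (y : M) :
    combination V c y ∈ Submodule.span ℝ (Set.range fun i => V i y) :=
  Submodule.sum_mem _ fun i _ => Submodule.smul_mem _ _ (Submodule.subset_span ⟨i, rfl⟩)

lemma exists_combination_eq {V : Fin d → ∀ y, SumFibre n L y} {y : M} {v : SumFibre n L y}
    (hv : v ∈ Submodule.span ℝ (Set.range fun i => V i y)) :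
    ∃ c : Euc d, combination V c y = v := by
  obtain ⟨c, hc⟩ := Submodule.mem_span_range_iff_exists_fun ℝ |>.1 hv
  exact ⟨WithLp.toLp 2 c, hc⟩

lemma combination_injective {V : Fin d → ∀ y, SumFibre n L y} {y : M}
    (hV : LinearIndependent ℝ fun i => V i y) :
    Function.Injective fun c : Euc d => combination V c y := by
  intro a b hab
  ext i
  have h := Fintype.linearIndependent_iff.1 hV (fun i => a i - b i) (by
    simp only [sub_smul, Finset.sum_sub_distrib]
    exact sub_eq_zero.2 hab) i
  exact sub_eq_zero.1 h

/-- The map `c ↦ ambient (∑ i, c i • V i) y`, as a linear map. -/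
noncomputable def ambientCombination (f : M → Euc m) (V : Fin d → ∀ y, SumFibre n L y) (y : M) :
    Euc d →L[ℝ] Euc m :=
  ∑ i, (EuclideanSpace.proj i : Euc d →L[ℝ] ℝ).smulRight (ambient n f (V i) y)

lemma ambientCombination_apply (f : M → Euc m) (V : Fin d → ∀ y, SumFibre n L y) (y : M)
    (c : Euc d) : ambientCombination f V y c = ambient n f (combination V c) y := by
  rw [ambient, combination, Prod.fst_sum, Prod.snd_sum, map_sum, AddSubmonoidClass.coe_finsetSum,
    ← Finset.sum_add_distrib, ambientCombination, sum_apply]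
  refine Finset.sum_congr rfl fun i _ => ?_
  change c i • (diff n f y (V i y).1 + ((V i y).2 : Euc m)) = _
  rw [smul_add, Prod.smul_fst, map_smul]
  rfl

lemma tauBar_combination (τ : ∀ x, L x ≃ₗᵢ[ℝ] L' x) (V : Fin d → ∀ y, SumFibre n L y)
    (c : Euc d) : tauBar n τ (combination V c) = combination (fun i => tauBar n τ (V i)) c := by
  funext y
  refine Prod.ext ?_ ?_
  · simp [tauBar, combination, Prod.fst_sum]
  · simp [tauBar, combination, Prod.snd_sum]

variable [IsManifold (𝓡 n) ∞ M]

lemma SmoothSectionOn.combination {V : Fin d → ∀ y, SumFibre n L y} {U : Set M}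
    (hV : ∀ i, SmoothSectionOn n (V i) U) (c : Euc d) :
    SmoothSectionOn n (combination V c) U := by
  refine ⟨?_, ?_⟩
  · have h : (fun y => (SubmanifoldGeometry.combination V c y).1) =
        fun y => ∑ i, c i • (V i y).1 := by
      funext y
      rw [SubmanifoldGeometry.combination, Prod.fst_sum]
      rfl
    rw [h]
    exact ContMDiffOn.sum_section fun i _ => (hV i).1.const_smul_section
  · have h : (fun y => ((SubmanifoldGeometry.combination V c y).2 : Euc m)) =
        fun y => ∑ i, c i • ((V i y).2 : Euc m) := by
      funext y
      rw [SubmanifoldGeometry.combination, Prod.snd_sum, AddSubmonoidClass.coe_finsetSum]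
      rfl
    rw [h]
    exact contMDiffOn_finsetSum fun i _ =>
      (contDiff_const_smul (c i)).contMDiff.comp_contMDiffOn (hV i).2

end Combinations

section Main

universe u

variable {n p q d : ℕ} {M : Type u} [TopologicalSpace M] [ChartedSpace (Euc n) M]
  [IsManifold (𝓡 n) ∞ M] {g : RiemMetric n M} {f : M → Euc (n + p)} {f' : M → Euc (n + q)}
  {L : M → Submodule ℝ (Euc (n + p))} {L' : M → Submodule ℝ (Euc (n + q))}

/-- The degeneracy at `t = 0` of `f + t V`, for the sections `V` of `D`, shows that `D ⊂ TM`. -/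
lemma le_prod_top_bot_of_stronglyGenuine (hf : IsIsometricImmersion n g f)
    (hf' : IsIsometricImmersion n g f') (hgen : StronglyGenuine n f f')
    (hL : ∀ x, L x ≤ normalSpace n f x) (hL' : ∀ x, L' x ≤ normalSpace n f' x)
    {τ : ∀ x, L x ≃ₗᵢ[ℝ] L' x} (hτ : SmoothBundleIsometry n τ) (hτpar : IsParallel n f f' τ)
    (hτsff : PreservesSecondFF n f f' τ) {D : ∀ x, Submodule ℝ (SumFibre n L x)}
    (hD : IsSubbundle n d D) (hnull : ∀ x, IsNull (phiImage n f f' τ x (D x))) (x : M) :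
    D x ≤ Submodule.prod ⊤ ⊥ := by
  obtain ⟨U, hU, hx, V, hV, hVD⟩ := hD.2 x
  intro v hv
  obtain ⟨c, rfl⟩ := exists_combination_eq (by rw [hVD x hx]; exact hv)
  obtain ⟨X, s, hXs, h0⟩ := exists_mem_ker_of_stronglyGenuine hf hf' hgen hL hL' hτ hτpar hτsff
    hnull hU (SmoothSectionOn.combination hV c)
    (fun y hy => by rw [← hVD y hy]; exact combination_mem_span V c y) hx 0
  set v := combination V c x with hvdef
  rw [zero_smul, add_zero] at h0
  have hs : s ≠ 0 := by
    rintro rfl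
    rw [zero_smul, add_zero] at h0
    exact hXs.elim (fun hX => hX (hf.diff_injective x (h0.trans (map_zero _).symm)))
      fun h => h rfl
  have h1 : (v.2 : Euc (n + p)) ∈ tangentImage n f x := by
    refine ⟨-(s⁻¹ • X) - v.1, ?_⟩
    have h2 : ambient n f (combination V c) x = diff n f x v.1 + v.2 := rfl
    rw [h2] at h0
    change diff n f x (-(s⁻¹ • X) - v.1) = _
    rw [map_sub, map_neg, map_smul]
    have h3 : s⁻¹ • diff n f x X + (diff n f x v.1 + v.2) = 0 := by
      rw [← inv_smul_smul₀ hs (diff n f x v.1 + (v.2 : Euc (n + p))), ← smul_add, h0, smul_zero]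
    rw [← sub_eq_zero, ← neg_eq_zero, ← h3]
    abel
  have h2 : (v.2 : Euc (n + p)) = 0 :=
    (Submodule.disjoint_def.1 (Submodule.orthogonal_disjoint _)) _ h1 (hL x v.2.2)
  exact ⟨trivial, (Submodule.mem_bot ℝ).2 (Subtype.ext h2)⟩

/-- Through every point `x₀` there is a ruling tangent to `D`. In the chart `P₀ ∘ f`, where `P₀` is
a left inverse of `f_*` at `x₀`, the pair `(f, f')` is a graph, and the degeneracy at `t = 1` of
`f + t V` for all sections `V` of `D` is the hypothesis of `exists_ball_add_mem_image`. -/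
lemma exists_ruling (hf : IsIsometricImmersion n g f)
    (hf' : IsIsometricImmersion n g f') (hgen : StronglyGenuine n f f')
    (hL : ∀ x, L x ≤ normalSpace n f x) (hL' : ∀ x, L' x ≤ normalSpace n f' x)
    {τ : ∀ x, L x ≃ₗᵢ[ℝ] L' x} (hτ : SmoothBundleIsometry n τ) (hτpar : IsParallel n f f' τ)
    (hτsff : PreservesSecondFF n f f' τ) {D : ∀ x, Submodule ℝ (SumFibre n L x)}
    (hD : IsSubbundle n d D) (hnull : ∀ x, IsNull (phiImage n f f' τ x (D x))) (x₀ : M) :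
    ∃ (S : Set M) (_ : ChartedSpace (Euc d) S) (_ : IsManifold (𝓡 d) ∞ S) (hx : x₀ ∈ S),
      Manifold.IsSmoothEmbedding (𝓡 d) (𝓡 n) ∞ (Subtype.val : S → M) ∧ IsPreconnected S ∧
      IsTotallyGeodesic n g d S ∧
      tangentOf n d S ⟨x₀, hx⟩ =
        (D x₀).map (LinearMap.fst ℝ (TangentSpace (𝓡 n) x₀) (L x₀)) ∧
      MapsToAffine f d S ∧ MapsToAffine f' d S := by
  have hDT := le_prod_top_bot_of_stronglyGenuine hf hf' hgen hL hL' hτ hτpar hτsff hD hnull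
  obtain ⟨U, hU, hxU, V, hV, hVD⟩ := hD.2 x₀
  let V' : Fin d → ∀ y, SumFibre n L' y := fun i => tauBar n τ (V i)
  have hVc : ∀ c, SmoothSectionOn n (combination V c) U := SmoothSectionOn.combination hV
  have hVcD : ∀ c, ∀ y ∈ U, combination V c y ∈ D y := fun c y hy => by
    rw [← hVD y hy]; exact combination_mem_span V c y
  obtain ⟨P₀, hP₀⟩ := exists_leftInverse_clm (diff n f x₀ : Euc n →L[ℝ] Euc (n + p))
    (hf.diff_injective x₀)
  have hfm : ∀ y, MDifferentiableAt (𝓡 n) 𝓘(ℝ, Euc (n + p)) f y := fun y =>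
    hf.1.contMDiffAt.mdifferentiableAt (by simp)
  have hfm' : ∀ y, MDifferentiableAt (𝓡 n) 𝓘(ℝ, Euc (n + q)) f' y := fun y =>
    hf'.1.contMDiffAt.mdifferentiableAt (by simp)
  have hbij : Function.Bijective (diff n (fun y => P₀ (f y)) x₀) := by
    have h1 : ⇑(diff n (fun y => P₀ (f y)) x₀) = fun X => X := by
      funext X
      have h2 := (P₀.hasMFDerivAt.comp x₀ (hfm x₀).hasMFDerivAt).mfderiv
      exact (congrArg (fun T : TangentSpace (𝓡 n) x₀ →L[ℝ] Euc n => T X) h2).trans (hP₀ X)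
    rw [h1]
    exact Function.bijective_id
  obtain ⟨φ, hφ, hx₀, hφf⟩ :=
    exists_chart_of_mfderiv_bijective (P₀.contMDiff.comp hf.1) hbij
  let Ω : Set (Euc n) := φ.target ∩ φ.symm ⁻¹' U
  have hΩ : IsOpen Ω := φ.isOpen_inter_preimage_symm hU
  have hu₀ : φ x₀ ∈ Ω := ⟨φ.map_source hx₀, by rwa [Set.mem_preimage, φ.left_inv hx₀]⟩
  let fp : Euc n → Euc (n + p) × Euc (n + q) := fun u => (f (φ.symm u), f' (φ.symm u))
  let e : Euc n → Euc d →L[ℝ] Euc (n + p) × Euc (n + q) := fun u =>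
    (ambientCombination f V (φ.symm u)).prod (ambientCombination f' V' (φ.symm u))
  let a : Euc d → Euc n → Euc (n + p) := fun c => ambient n f (combination V c) ∘ φ.symm
  let a' : Euc d → Euc n → Euc (n + q) := fun c =>
    ambient n f' (tauBar n τ (combination V c)) ∘ φ.symm
  have hea : ∀ u c, e u c = (a c u, a' c u) := fun u c => Prod.ext
    (ambientCombination_apply f V _ c)
    ((ambientCombination_apply f' V' _ c).trans
      (congrArg (fun W => ambient n f' W (φ.symm u)) (tauBar_combination τ V c).symm))
  have hVs := fun c => (hVc c).smoothMapOn_ambient hf.1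
  have hVs' := fun c => ((hVc c).tauBar hτ hU).smoothMapOn_ambient hf'.1
  have ha : ∀ c, ContDiffOn ℝ ∞ (a c) Ω := fun c => (hVs c).contDiffOn_chart hφ
  have ha' : ∀ c, ContDiffOn ℝ ∞ (a' c) Ω := fun c => (hVs' c).contDiffOn_chart hφ
  have hfO : ContDiffOn ℝ ∞ (f ∘ φ.symm) Ω :=
    SmoothMapOn.contDiffOn_chart hφ (U := U) hf.1.contMDiffOn
  have hfO' : ContDiffOn ℝ ∞ (f' ∘ φ.symm) Ω :=
    SmoothMapOn.contDiffOn_chart hφ (U := U) hf'.1.contMDiffOn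
  have hfp : ContDiffOn ℝ ∞ fp Ω := hfO.prodMk hfO'
  have he : ContDiffOn ℝ ∞ e Ω := by
    rw [contDiffOn_clm_apply]
    intro c
    exact ((ha c).prodMk (ha' c)).congr fun u _ => hea u c
  have hdiff : ∀ {F : Type} [NormedAddCommGroup F] [NormedSpace ℝ F] {b : Euc n → F},
      ContDiffOn ℝ ∞ b Ω → ∀ u ∈ Ω, DifferentiableAt ℝ b u := fun hb u hu =>
    (hb.contDiffAt (hΩ.mem_nhds hu)).differentiableAt (by simp)
  obtain ⟨ε, hε, hball⟩ := exists_ball_add_mem_image hΩ hu₀ hfp he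
    (P₀.comp (ContinuousLinearMap.fst ℝ _ _))
    (fun u hu => by
      change P₀ (f (φ.symm u)) = u
      have := hφf _ (φ.map_target hu.1)
      rw [φ.right_inv hu.1] at this
      exact this.symm)
    (fun u hu c => by
      obtain ⟨X, s, hXs, h0⟩ := exists_mem_ker_of_stronglyGenuine hf hf' hgen hL hL' hτ hτpar
        hτsff hnull hU (hVc c) (hVcD c) hu.2 1
      have h0' := norm_diff_add_eq hf hf' hL hL' hτ hτpar hτsff hU (hVc c) hu.2
        (hVcD c _ hu.2) (hnull _) X 1 s
      rw [h0, norm_zero, eq_comm, norm_eq_zero] at h0'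
      rw [one_smul] at h0 h0'
      obtain ⟨w, rfl⟩ := (chartFrame_bijective hφ hu.1).2 X
      refine ⟨w, s, hXs.imp_left fun h hw => h (by rw [hw, map_zero]), ?_⟩
      have h1 : fderiv ℝ fp u w = (diff n f (φ.symm u) (chartFrame φ u w),
          diff n f' (φ.symm u) (chartFrame φ u w)) := by
        rw [diff_chartFrame hφ hu.1 (hfm _), diff_chartFrame hφ hu.1 (hfm' _)]
        have h3 : HasFDerivAt fp
            ((fderiv ℝ (f ∘ φ.symm) u).prod (fderiv ℝ (f' ∘ φ.symm) u)) u :=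
          (hdiff hfO u hu).hasFDerivAt.prodMk (hdiff hfO' u hu).hasFDerivAt
        rw [h3.fderiv]
        rfl
      have h2 : fderiv ℝ e u w c =
          (diff n (ambient n f (combination V c)) (φ.symm u) (chartFrame φ u w),
          diff n (ambient n f' (tauBar n τ (combination V c))) (φ.symm u)
            (chartFrame φ u w)) := by
        rw [diff_chartFrame hφ hu.1 ((hVs c).mdifferentiableAt hU hu.2),
          diff_chartFrame hφ hu.1 ((hVs' c).mdifferentiableAt hU hu.2)]
        have h3 : HasFDerivAt (fun u => e u c) _ u :=
          (hdiff he u hu).hasFDerivAt.clm_apply (hasFDerivAt_const c u)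
        have h4 : HasFDerivAt (fun u => e u c)
            ((fderiv ℝ (a c) u).prod (fderiv ℝ (a' c) u)) u :=
          ((hdiff (ha c) u hu).hasFDerivAt.prodMk
            (hdiff (ha' c) u hu).hasFDerivAt).congr_of_eventuallyEq
            (Filter.Eventually.of_forall fun u => hea u c)
        have h5 := congrArg (fun T : Euc n →L[ℝ] Euc (n + p) × Euc (n + q) => T w)
          (h3.unique h4)
        simpa using h5
      rw [h1, h2, hea]
      exact Prod.ext h0 h0')
  -- Since `D` lies in `TM`, the linear parts are `f_*` and `f'_*` composed with a frame of `D`.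
  have hsnd : ∀ c, (combination V c x₀).2 = 0 := fun c =>
    (Submodule.mem_bot ℝ).1 (hDT x₀ (hVcD c x₀ hxU)).2
  let E := ambientCombination f V x₀
  let E' := ambientCombination f' V' x₀
  have hE : ∀ c, E c = diff n f x₀ (combination V c x₀).1 := fun c => by
    rw [ambientCombination_apply, ambient, hsnd, Submodule.coe_zero, add_zero]
  have hE' : ∀ c, E' c = diff n f' x₀ (combination V c x₀).1 := fun c => by
    rw [ambientCombination_apply, ← tauBar_combination, ambient, tauBar, hsnd, map_zero,
      Submodule.coe_zero, add_zero]
  have hΘ : ∀ c, P₀ (E c) = (combination V c x₀).1 := fun c => by rw [hE]; exact hP₀ _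
  have hind : LinearIndependent ℝ fun i => V i x₀ := by
    rw [linearIndependent_iff_card_eq_finrank_span, Set.finrank, hVD x₀ hxU, hD.1,
      Fintype.card_fin]
  have hinj : Function.Injective fun c => (combination V c x₀).1 := fun c c' h =>
    combination_injective hind (Prod.ext h ((hsnd c).trans (hsnd c').symm))
  have hb : ∀ c, ‖c‖ < ε → φ x₀ + P₀ (E c) ∈ φ.target ∧
      f (φ.symm (φ x₀ + P₀ (E c))) = f x₀ + E c ∧
      f' (φ.symm (φ x₀ + P₀ (E c))) = f' x₀ + E' c := by
    intro c hc
    obtain ⟨h1, h2⟩ := hball c hc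
    have he₀ : e (φ x₀) = E.prod E' := by simp only [e, E, E', φ.left_inv hx₀]
    have hf₀ : fp (φ x₀) = (f x₀, f' x₀) := by simp only [fp, φ.left_inv hx₀]
    rw [he₀] at h1 h2
    rw [hf₀] at h2
    exact ⟨h1.1, congrArg Prod.fst h2, congrArg Prod.snd h2⟩
  obtain ⟨S, cS, mS, hx, hemb, hpre, hgeo, htan, hA, hA'⟩ :=
    exists_ruling_submanifold (g := g) (Θ := P₀.comp E) (E := E) (E' := E') hf hφ hx₀
      (fun c c' h => hinj ((hΘ c).symm.trans (h.trans (hΘ c'))))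
      (fun c c' h => hinj ((hΘ c).symm.trans ((congrArg P₀ h).trans (hΘ c'))))
      (fun c c' h => hinj (hf'.diff_injective x₀ ((hE' c).symm.trans (h.trans (hE' c')))))
      hε (fun c hc => (hb c hc).1) (fun c hc => (hb c hc).2.1) (fun c hc => (hb c hc).2.2)
  refine ⟨S, cS, mS, hx, hemb, hpre, hgeo, htan.trans ?_, hA, hA'⟩
  ext X
  rw [Submodule.mem_comap, Submodule.mem_map]
  constructor
  · rintro ⟨c, hc⟩
    exact ⟨combination V c x₀, hVcD c x₀ hxU, hf.diff_injective x₀ ((hE c).symm.trans hc)⟩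
  · rintro ⟨v, hv, rfl⟩
    obtain ⟨c, rfl⟩ := exists_combination_eq (by rw [hVD x₀ hxU]; exact hv)
    exact ⟨c, hE c⟩

end Main

end SubmanifoldGeometry

open SubmanifoldGeometry in
theorem mainTheorem3 {n p q ℓ d : ℕ} {M : Type*} [TopologicalSpace M] [T2Space M]
    [SecondCountableTopology M] [ChartedSpace (Euc n) M] [IsManifold (𝓡 n) ∞ M]
    (g : RiemMetric n M)
    (f : M → Euc (n + p)) (f' : M → Euc (n + q))
    (hf : IsIsometricImmersion n g f) (hf' : IsIsometricImmersion n g f')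
    (hgen : StronglyGenuine n f f')
    (L : M → Submodule ℝ (Euc (n + p))) (L' : M → Submodule ℝ (Euc (n + q)))
    (hL : IsNormalSubbundle n f ℓ L) (hL' : IsNormalSubbundle n f' ℓ L')
    (τ : ∀ x, L x ≃ₗᵢ[ℝ] L' x)
    (hτ : SmoothBundleIsometry n τ)
    (hτpar : IsParallel n f f' τ)
    (hτsff : PreservesSecondFF n f f' τ)
    (D : ∀ x, Submodule ℝ (SumFibre n L x))
    (hD : IsSubbundle n d D)
    (hnull : ∀ x, IsNull (phiImage n f f' τ x (D x))) :
    (∀ x, D x ≤ Submodule.prod ⊤ ⊥) ∧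
    ∃ V : Set M, IsOpen V ∧ Dense V ∧ ∀ x ∈ V,
      MutuallyRuledOn n g f f' d
        (fun y => (D y).map (LinearMap.fst ℝ (TangentSpace (𝓡 n) y) (L y)))
        (connectedComponentIn V x) := by
  refine ⟨le_prod_top_bot_of_stronglyGenuine hf hf' hgen hL.1 hL'.1 hτ hτpar hτsff hD hnull,
    Set.univ, isOpen_univ, dense_univ, fun z _ x hxz => ?_⟩
  obtain ⟨S, cS, mS, hx, hemb, hpre, hgeo, htan, hA, hA'⟩ :=
    exists_ruling hf hf' hgen hL.1 hL'.1 hτ hτpar hτsff hD hnull x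
  refine ⟨S, cS, mS, hx, hemb, ?_, hgeo, htan, hA, hA'⟩
  rw [connectedComponentIn_eq hxz]
  exact hpre.subset_connectedComponentIn hx (Set.subset_univ S)
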